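/- Conventions. Let $\mathbb T=\mathbb R\cup\{-\infty\}$. For $y\in\mathbb T^N$ let $I(y)=\{i: y_i=-\infty\}$ (the refined sedentarity; $|I(y)|$ is the sedentarity, and $y$ is mobile if $I(y)=\varnothing$). A convex polyhedral domain in $\mathbb T^N$ is the closure of a non-empty intersection $D\subset\mathbb R^N$ of finitely many half-spaces $\{jx\le a\}$, $j\in\mathbb Z^N$, $a\in\mathbb R$; write $L_D$ for the linear subspace parallel to $D$. An $n$-dimensional polyhedral complex is a finite union of such $n$-dimensional domains (facets), any of which intersect in a common face or not at all; all complexes are regular at infinity: for each face $E$ and each $I\subset\{1,\dots,N\}$, the part of (the closure of) $E$ with refined sedentarity $I$ is empty or a polyhedral domain of dimension $\dim E-|I|$. A complex with integer weights $w(D)$ on its facets is balanced if at every codimension-one mobile face $E$ one has $\sum_{D\supset E}w(D)\epsilon_D=0$ in $\mathbb R^N/L_E$, where $\epsilon_D$ is the outward primitive integer vector parallel to $D$ modulo $L_E$; unweighted means all weights $1$. A tropical space is a topological space $X$ with finitely many charts $\phi_\alpha:U_\alpha\to Y_\alpha\subset\mathbb T^{N_\alpha}$ (open embeddings of the members of an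 open cover into balanced polyhedral complexes) such that the changes of charts are locally given by integral affine maps $x\mapsto Ax+b$ (extended by continuity to infinite points), and such that, whenever a sequence $x_j\in U_\alpha$ has $\phi_\alpha(x_j)\to y\in\mathbb T^{N_\alpha}$, either $x_j$ converges in $X$ or some coordinate is $-\infty$ at $y$ and finite on all of $\phi_\alpha(U_\alpha)$. For $x\in X$, in a chart, the wave tangent space $W(x)$ is the lineality space of the tangent cone of $Y_\alpha$ at a nearby mobile point; $F_k(x)\subset\Lambda^k(\mathbb R^{N}/\mathbb R^{I(x)})$ is the subgroup generated by the products $v_1\wedge\dots\wedge v_k$ of integer vectors $v_j$ all parallel to one and the same face, of the same sedentarity as $x$, containing $x$. The strata of $X$ are the classes of points that can be joined by a path along which $\dim W$ and the sedentarity are constant. $H_{p,q}(X)=H_q(X;F_p)$ and $H_q(X;F_p\otimes\mathbb R)$ are the homology groups of the complexes of finite sums $\sum\beta_\sigma\sigma$, where $\sigma$ runs over singular $q$-simplices that lie in one chart and map each open face into one stratum, and $\beta_\sigma$ is in the coefficient group ($F_p$ or $F_p\otimes\mathbb R$) along the open simplex; the differential is the singular one followed by the natural maps of coefficients (inclusions,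 and projections along the new infinite coordinate directions). Wave cochains $C^r(X;\mathcal W_1)$ assign to each such $r$-simplex $\sigma$ an element of $W(\sigma)$, the value of $W$ along the open simplex. Eigenwave. Let $X$ be compact. For each $x\in X$ choose a nearby mobile point $y_x$ which maps to $x$ under the projection along the directions in $I(x)$ ($y_x=x$ if $x$ is mobile). The eigenwave $\phi\in H^1(X;\mathcal W_1)$ is the class of $\tau\mapsto y_{\tau(1)}-y_{\tau(0)}\in W(\tau)$. The cap product with $\phi$ is $H_q(X;F_p)\to H_{q-1}(X;F_{p+1}\otimes\mathbb R)$, induced by $a\cap\sum\beta_\sigma\sigma=\sum\bigl(a(\sigma_{01})\wedge\beta_\sigma\bigr)\,\sigma_{1\dots q}$, where $a(\sigma_{01})$ is pushed to $\sigma$ and projected to $\mathbb R^N/\mathbb R^{I(\sigma)}$, and the product is then pushed to $\sigma_{1\dots q}$. Straight classes. A straight tropical $p$-cycle is a subspace $Z\subset X$ with an integer weight function $w$ defined on an open dense subset of $Z$ such that for every chart $\phi_\alpha$ there is a weighted balanced $p$-dimensional polyhedral complex $Z_\alpha\subset\mathbb T^{N_\alpha}$ with $\phi_\alpha(Z\cap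 U_\alpha)$ open in $Z_\alpha$ and, over the relative interior of each facet of $Z_\alpha$, $w$ defined and equal to the weight of that facet. For a sufficiently fine finite triangulation of $Z$ (with ordered vertices; each open $p$-simplex inside the relative interior of a facet of $Z$ in a chart containing the closed simplex, and all simplices compatible with the strata of $X$) the chain $\sum_\sigma w(\sigma)\operatorname{Vol}_\sigma\sigma$ is a cycle, where $\operatorname{Vol}_\sigma$ is the generator of $\Lambda^p$ of the lattice of integer vectors tangent to the facet that is positive for the orientation of $\sigma$. $H^{straight}_{p,p}(X)\subset H_{p,p}(X)$ is the subgroup of the classes of such cycles. Theorem. Let $X$ be a compact tropical space (regular at infinity), $p\ge 1$, and $\gamma\in H^{straight}_{p,p}(X)$. Then $\phi\cap\gamma=0$ in $H_{p-1}(X;F_{p+1}\otimes\mathbb R)$; that is, for every cochain $a$ representing $\phi$ and every cycle $c$ representing $\gamma$, the chain $a\cap c$ is a cycle whose homology class is zero. (For $p=0$ the target group is $H_{-1}=0$.) -/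

import Mathlib

open Set Filter Topology
open scoped DirectSum

noncomputable section

namespace TropGeom

/-! ### The space `𝕋^N`, where `𝕋 = [-∞, ∞)` -/

/-- `ℝ^N`. -/
abbrev Vec (N : ℕ) : Type := Fin N → ℝ

/-- `𝕋^N` with `𝕋 = ℝ ∪ {-∞}` (order topology on `𝕋`, product topology on `𝕋^N`). -/
abbrev TropVec (N : ℕ) : Type := Fin N → WithBot ℝ

/-- The inclusion `ℝ^N ⊆ 𝕋^N`. -/
def toTrop {N : ℕ} (x : Vec N) : TropVec N := fun i => (x i : WithBot ℝ)

/-- The refined sedentarity: the set of coordinates equal to `-∞`. -/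
def refSed {N : ℕ} (y : TropVec N) : Set (Fin N) := {i | y i = ⊥}

/-- The sedentarity. -/
def sed {N : ℕ} (y : TropVec N) : ℕ := (refSed y).ncard

/-- Coordinates of a point of `𝕋^N`, with `0` in place of `-∞`. This identifies the stratum
`𝕋°_I` with the coordinate subspace `{z | z_i = 0 for i ∈ I}` of `ℝ^N`, i.e. with
`ℝ^N / ℝ^I`. -/
def finPart {N : ℕ} (y : TropVec N) : Vec N := fun i => (y i).unbotD 0

open Classical in
/-- The projection `ℝ^N → ℝ^N / ℝ^I` along the coordinate directions in `I`, the quotient being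
realised as the coordinate subspace `{z | z_i = 0 for i ∈ I}`. -/
def killCoords {N : ℕ} (I : Set (Fin N)) : Vec N →ₗ[ℝ] Vec N :=
  LinearMap.pi fun i => if i ∈ I then 0 else LinearMap.proj i

/-- Membership in the lattice `ℤ^N`. -/
def IsIntegral {N : ℕ} (v : Vec N) : Prop := ∀ i, ∃ m : ℤ, v i = m

/-! ### Integral affine maps `𝕋^N ⇢ 𝕋^M` -/

/-- `c · x` for an integer `c` and `x ∈ 𝕋`; at `x = -∞` this is the continuous extension, used
only for `c ≥ 0`. -/
def intMul (c : ℤ) (x : WithBot ℝ) : WithBot ℝ :=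
  if c = 0 then 0 else x.map fun r => (c : ℝ) * r

/-- The map `x ↦ A x + b` of `ℝ^N` to `ℝ^M` extends continuously to `y ∈ 𝕋^N` (with value
in `𝕋^M`). -/
def AffDefinedAt {N M : ℕ} (A : Matrix (Fin M) (Fin N) ℤ) (y : TropVec N) : Prop :=
  ∀ j i, y i = ⊥ → 0 ≤ A j i

/-- The value at `y ∈ 𝕋^N` of the continuous extension of `x ↦ A x + b`. -/
def affEval {N M : ℕ} (A : Matrix (Fin M) (Fin N) ℤ) (b : Vec M) (y : TropVec N) : TropVec M :=
  fun j => (∑ i, intMul (A j i) (y i)) + (b j : WithBot ℝ)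

/-- On the set `V`, the map `g` is `f` followed by the integral affine map `x ↦ A x + b`. -/
def InducedByAffine {X : Type*} {N M : ℕ} (V : Set X) (f : X → TropVec N) (g : X → TropVec M)
    (A : Matrix (Fin M) (Fin N) ℤ) (b : Vec M) : Prop :=
  ∀ z ∈ V, AffDefinedAt A (f z) ∧ g z = affEval A b (f z)

/-- The linear part of an integral affine map. -/
def linPart {N M : ℕ} (A : Matrix (Fin M) (Fin N) ℤ) : Vec N →ₗ[ℝ] Vec M :=
  Matrix.toLin' (A.map fun c : ℤ => (c : ℝ))

/-! ### Polyhedral complexes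

A convex polyhedral domain in `𝕋^N` is the closure in `𝕋^N` of its non-infinite part, a
non-empty polyhedron with rational slopes in `ℝ^N`; it is recorded by that non-infinite part. -/

/-- The intersection of finitely many half-spaces `j x ≤ a` with `j ∈ ℤ^N`, `a ∈ ℝ`. -/
def halfSpaces {N : ℕ} (H : Finset ((Fin N → ℤ) × ℝ)) : Set (Vec N) :=
  {x | ∀ h ∈ H, ∑ i, (h.1 i : ℝ) * x i ≤ h.2}

/-- A polyhedron with rational slopes. -/
def IsRatPoly {N : ℕ} (D : Set (Vec N)) : Prop := ∃ H, D = halfSpaces H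

/-- `E` is a (non-empty) mobile face of `D`: the intersection of `D` with the boundaries of some
of its defining half-spaces. -/
def IsFace {N : ℕ} (E D : Set (Vec N)) : Prop :=
  E.Nonempty ∧ ∃ H, D = halfSpaces H ∧
    ∃ K ⊆ H, E = {x | x ∈ D ∧ ∀ h ∈ K, ∑ i, (h.1 i : ℝ) * x i = h.2}

/-- The dimension of a polyhedron. -/
def polyDim {N : ℕ} (D : Set (Vec N)) : ℕ := Module.finrank ℝ (vectorSpan ℝ D)

/-- The domain in `𝕋^N` with non-infinite part `D`. -/
def domain {N : ℕ} (D : Set (Vec N)) : Set (TropVec N) := closure (toTrop '' D)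

/-- The part of the domain of `D` in the stratum `𝕋°_I ≅ ℝ^N / ℝ^I`. -/
def sedPart {N : ℕ} (I : Set (Fin N)) (D : Set (Vec N)) : Set (Vec N) :=
  finPart '' (domain D ∩ {y | refSed y = I})

/-- Regularity at infinity: each intersection with a stratum `𝕋°_I` is empty or a polyhedral
domain of dimension `dim D - |I|`. -/
def RegularAtInfinity {N : ℕ} (D : Set (Vec N)) : Prop :=
  ∀ I, (sedPart I D).Nonempty →
    IsRatPoly (sedPart I D) ∧ polyDim (sedPart I D) + I.ncard = polyDim D

/-- An `n`-dimensional polyhedral complex in `𝕋^N`, regular at infinity. -/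
structure PolyComplex (N n : ℕ) where
  /-- the non-infinite parts of the facets -/
  facets : Finset (Set (Vec N))
  isRatPoly : ∀ D ∈ facets, IsRatPoly D
  nonempty : ∀ D ∈ facets, D.Nonempty
  dim_eq : ∀ D ∈ facets, polyDim D = n
  inter_isFace : ∀ s ⊆ facets, (⋂ D ∈ s, D).Nonempty → ∀ D ∈ s, IsFace (⋂ D' ∈ s, D') D
  regular : ∀ D ∈ facets, ∀ E, IsFace E D → RegularAtInfinity E

/-- `u` is an integer vector representing the outward primitive integer vector parallel to the
image of `D` in the quotient of `ℝ^N` by the linear subspace parallel to its codimension one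
face `E`: it is tangent to `D`, points from `E` into `D`, and generates the lattice of
integer vectors tangent to `D` modulo those tangent to `E`. -/
def IsOutwardPrimitive {N : ℕ} (D E : Set (Vec N)) (u : Vec N) : Prop :=
  IsIntegral u ∧ u ∈ vectorSpan ℝ D ∧ u ∉ vectorSpan ℝ E ∧
    (∃ x ∈ E, ∃ t : ℝ, 0 < t ∧ x + t • u ∈ D) ∧
    ∀ v ∈ vectorSpan ℝ D, IsIntegral v → ∃ m : ℤ, v - (m : ℝ) • u ∈ vectorSpan ℝ E

namespace PolyComplex

variable {N n : ℕ} (Y : PolyComplex N n)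

/-- The underlying subset of `𝕋^N`. -/
def support : Set (TropVec N) := ⋃ D ∈ Y.facets, domain D

/-- The non-infinite part of the underlying set. -/
def mobilePart : Set (Vec N) := ⋃ D ∈ Y.facets, D

open Classical in
/-- The weighted balancing condition, for integer weights `w` on the facets:
`∑ w(D) ε_D = 0` in `ℝ^N / L(E)` for every codimension one mobile face `E`, the sum being over
the facets adjacent to `E`. -/
def IsBalanced (w : Set (Vec N) → ℤ) : Prop :=
  ∀ E, (∃ D ∈ Y.facets, IsFace E D) → polyDim E + 1 = n →
    ∀ u : Set (Vec N) → Vec N, (∀ D ∈ Y.facets, E ⊆ D → IsOutwardPrimitive D E (u D)) →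
      ∑ D ∈ Y.facets with E ⊆ D, (w D : ℝ) • u D ∈ vectorSpan ℝ E

/-! ### Tangent spaces and coefficient groups -/

/-- The cone `Σ(z)` of directions `u` at a mobile point `z` with `z + ε u ∈ Y` for all
small `ε > 0`. -/
def tangentCone (z : Vec N) : Set (Vec N) :=
  {u | ∀ᶠ ε in 𝓝[>] (0 : ℝ), z + ε • u ∈ Y.mobilePart}

/-- The lineality space of a cone: the largest linear subspace along which it is invariant under
translations. -/
def lineality (C : Set (Vec N)) : Submodule ℝ (Vec N) where
  carrier := {u | ∀ v ∈ C, ∀ t : ℝ, v + t • u ∈ C}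
  add_mem' {a b} ha hb v hv t := by
    simpa [smul_add, add_assoc] using hb _ (ha v hv t) t
  zero_mem' v hv t := by simpa using hv
  smul_mem' c u hu v hv t := by simpa [smul_smul] using hu v hv (t * c)

/-- The mobile point obtained from `y` on replacing `-∞` by `-M`; for large `M` this is a nearby
mobile point of `y`. -/
def mobileShift (y : TropVec N) (M : ℝ) : Vec N := fun i => (y i).unbotD (-M)

/-- The wave tangent space `W(y)`: the lineality space of the cone `Σ(y_m)` at a nearby mobile
point `y_m` of `y`. -/
def waveSpace (y : TropVec N) : Submodule ℝ (Vec N) where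
  carrier := {u | ∀ᶠ M in atTop, u ∈ lineality (Y.tangentCone (mobileShift y M))}
  add_mem' ha hb := by
    filter_upwards [ha, hb] with M h1 h2 using Submodule.add_mem _ h1 h2
  zero_mem' := Eventually.of_forall fun _ => Submodule.zero_mem _
  smul_mem' c u hu := by
    filter_upwards [hu] with M h using Submodule.smul_mem _ c h

/-- The group `F_k(y)`: the subgroup of the `k`-th exterior power of `ℝ^N / ℝ^I` (with `I` the
refined sedentarity of `y`) generated by the products `v_1 ∧ ⋯ ∧ v_k` of integer vectors which are
all parallel to one face of `Y ∩ 𝕋°_I` containing `y`. It is enough to take the maximal such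
faces, and these are the intersections of facets `D ∋ y` with `𝕋°_I`. -/
def coeffZ (k : ℕ) (y : TropVec N) : AddSubgroup (ExteriorAlgebra ℝ (Vec N)) :=
  AddSubgroup.closure {ω | ∃ D ∈ Y.facets, y ∈ domain D ∧ ∃ v : Fin k → Vec N,
    (∀ j, IsIntegral (v j) ∧ v j ∈ (vectorSpan ℝ D).map (killCoords (refSed y))) ∧
    ω = ExteriorAlgebra.ιMulti ℝ k v}

/-- `F_k(y) ⊗ ℝ`, as the real span of `F_k(y)`. -/
def coeffR (k : ℕ) (y : TropVec N) : AddSubgroup (ExteriorAlgebra ℝ (Vec N)) :=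
  (Submodule.span ℝ (Y.coeffZ k y : Set (ExteriorAlgebra ℝ (Vec N)))).toAddSubgroup

end PolyComplex

/-! ### Tropical spaces -/

/-- A tropical space (regular at infinity) structure on `X`: finitely many compatible charts to
balanced polyhedral complexes, subject to the finite type condition. -/
structure TropicalSpace (X : Type*) [TopologicalSpace X] where
  numCharts : ℕ
  N : Fin numCharts → ℕ
  dim : Fin numCharts → ℕ
  Y : ∀ α, PolyComplex (N α) (dim α)
  balanced : ∀ α, (Y α).IsBalanced fun _ => 1
  U : Fin numCharts → Set X
  isOpen_U : ∀ α, IsOpen (U α)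
  cover : ∀ x, ∃ α, x ∈ U α
  φ : ∀ α, X → TropVec (N α)
  isEmbedding : ∀ α, IsEmbedding ((U α).domRestrict (φ α))
  isOpen_image : ∀ α, ∃ O, IsOpen O ∧ φ α '' U α = O ∩ (Y α).support
  compat : ∀ α β, ∀ x ∈ U α ∩ U β, ∃ V, IsOpen V ∧ x ∈ V ∧ V ⊆ U α ∩ U β ∧
    ∃ A b, InducedByAffine V (φ α) (φ β) A b
  finiteType : ∀ α, ∀ u : ℕ → X, (∀ j, u j ∈ U α) → ∀ y : TropVec (N α),
    Tendsto (fun j => φ α (u j)) atTop (𝓝 y) →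
      (∃ x, Tendsto u atTop (𝓝 x)) ∨ ∃ i, y i = ⊥ ∧ ∀ z ∈ U α, φ α z i ≠ ⊥

/-- The relatively open face of the standard simplex with vertex set `J`. -/
def openFace {q : ℕ} (J : Set (Fin (q + 1))) : Set (stdSimplex ℝ (Fin (q + 1))) :=
  {t | ∀ i, 0 < t i ↔ i ∈ J}

lemma map_mem_openFace {r q : ℕ} (f : Fin (r + 1) ↪o Fin (q + 1)) (J : Set (Fin (r + 1)))
    {t : stdSimplex ℝ (Fin (r + 1))} (ht : t ∈ openFace J) :
    stdSimplex.map f t ∈ openFace (f '' J) := by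
  classical
  intro j
  have key : (stdSimplex.map f t) j = ∑ i, if f i = j then t i else 0 := by
    rw [stdSimplex.map_coe, FunOnFinite.linearMap_apply_apply, Finset.sum_filter]
  rw [key]
  constructor
  · intro h
    obtain ⟨i, -, hi⟩ := Finset.exists_ne_zero_of_sum_ne_zero h.ne'
    have hf : f i = j := by
      by_contra hne
      simp [hne] at hi
    have h0 : t i ≠ 0 := by simpa [hf] using hi
    exact ⟨i, (ht i).1 (lt_of_le_of_ne (stdSimplex.zero_le t i) h0.symm), hf⟩
  · rintro ⟨i, hi, rfl⟩
    refine Finset.sum_pos' (fun k _ => ?_) ⟨i, Finset.mem_univ _, ?_⟩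
    · split_ifs
      · exact stdSimplex.zero_le t k
      · exact le_rfl
    · simpa using (ht i).2 hi

namespace TropicalSpace

variable {X : Type*} [TopologicalSpace X] (S : TropicalSpace X)

/-- On the open set `V ⊆ U_α ∩ U_β`, the change of charts from `α` to `β` is `x ↦ A x + b`. -/
def IsTransition (α β : Fin S.numCharts) (V : Set X)
    (A : Matrix (Fin (S.N β)) (Fin (S.N α)) ℤ) (b : Vec (S.N β)) : Prop :=
  IsOpen V ∧ V ⊆ S.U α ∩ S.U β ∧ InducedByAffine V (S.φ α) (S.φ β) A b

/-- Combinatorial equivalence: two points are joined by a path along which the dimension of the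
wave tangent space and the sedentarity are constant (these do not depend on the chart). The
classes are the combinatorial strata. -/
def CombEquiv (x x' : X) : Prop :=
  ∃ d k : ℕ, JoinedIn {z | ∀ α, z ∈ S.U α →
    Module.finrank ℝ ((S.Y α).waveSpace (S.φ α z)) = d ∧ sed (S.φ α z) = k} x x'

/-! ### Tropical chains -/

/-- A singular `q`-simplex together with a chart containing its image, such that each relatively
open face of the simplex is mapped to a single combinatorial stratum. -/
structure Cell (q : ℕ) where
  chart : Fin S.numCharts
  toMap : C(stdSimplex ℝ (Fin (q + 1)), X)
  mem_chart : ∀ t, toMap t ∈ S.U chart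
  strat : ∀ J : Set (Fin (q + 1)), ∀ t ∈ openFace J, ∀ t' ∈ openFace J,
    S.CombEquiv (toMap t) (toMap t')

instance (q : ℕ) : DecidableEq (S.Cell q) := Classical.decEq _

variable {S}

namespace Cell

variable {q r : ℕ}

/-- The face of a simplex spanned by the vertices `f 0 < ⋯ < f r`. -/
def restrict (s : S.Cell q) (f : Fin (r + 1) ↪o Fin (q + 1)) : S.Cell r where
  chart := s.chart
  toMap := s.toMap.comp ⟨stdSimplex.map f, stdSimplex.continuous_map f⟩
  mem_chart _ := s.mem_chart _
  strat J _ ht _ ht' :=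
    s.strat (f '' J) _ (map_mem_openFace f J ht) _ (map_mem_openFace f J ht')

/-- The `i`-th codimension one face. -/
def face (s : S.Cell (q + 1)) (i : Fin (q + 2)) : S.Cell q :=
  s.restrict (Fin.succAboveOrderEmb i)

/-- The first edge `σ_{01}`. -/
def firstEdge (s : S.Cell (q + 1)) : S.Cell 1 :=
  s.restrict (Fin.castLEOrderEmb (by omega : 1 + 1 ≤ q + 1 + 1))

/-- The image of the barycenter. It lies in the stratum of the open simplex, so the coefficient
groups of the simplex are those at this point. -/
def base (s : S.Cell q) : X := s.toMap stdSimplex.barycenter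

/-- The base point in the chart of the simplex. -/
def pt (s : S.Cell q) : TropVec (S.N s.chart) := S.φ s.chart s.base

/-- The map induced on exterior algebras by the projection to the tangent space at the base
point of `s`. -/
def project (s : S.Cell q) :
    ExteriorAlgebra ℝ (Vec (S.N s.chart)) →+ ExteriorAlgebra ℝ (Vec (S.N s.chart)) :=
  (ExteriorAlgebra.map (killCoords (refSed s.pt))).toLinearMap.toAddMonoidHom

end Cell

variable (S)

/-- Formal sums of simplices (with a chart) with arbitrary coefficients. -/
abbrev PreChain (q : ℕ) : Type _ :=
  ⨁ s : S.Cell q, ExteriorAlgebra ℝ (Vec (S.N s.chart))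

/-- The boundary: the singular differential followed by the maps of coefficients. In a chart
these are inclusions if the sedentarity does not change, and projections along the additional
divisorial directions otherwise. -/
def boundary (q : ℕ) : S.PreChain (q + 1) →+ S.PreChain q :=
  DirectSum.toAddMonoid fun s => ∑ i : Fin (q + 2), ((-1 : ℤ) ^ (i : ℕ)) •
    (DirectSum.of (fun s : S.Cell q => ExteriorAlgebra ℝ (Vec (S.N s.chart))) (s.face i)).comp
      (s.face i).project

/-- A system of coefficient groups, given in every chart. -/
abbrev Coeff : Type _ :=
  ∀ α : Fin S.numCharts, X → AddSubgroup (ExteriorAlgebra ℝ (Vec (S.N α)))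

/-- The coefficients `F_k`. -/
def FZ (k : ℕ) : S.Coeff := fun α x => (S.Y α).coeffZ k (S.φ α x)

/-- The coefficients `F_k ⊗ ℝ`. -/
def FR (k : ℕ) : S.Coeff := fun α x => (S.Y α).coeffR k (S.φ α x)

variable {S}

/-- Formal sums whose coefficient at each simplex is in the coefficient group of the simplex. -/
def chains (G : S.Coeff) (q : ℕ) : AddSubgroup (S.PreChain q) where
  carrier := {c | ∀ s, c s ∈ G s.chart s.base}
  add_mem' ha hb s := by simpa using add_mem (ha s) (hb s)
  zero_mem' s := by simp
  neg_mem' {c} ha s := by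
    have h : (-c) s = -(c s) := rfl
    rw [h]
    exact neg_mem (ha s)

/-- The identification of coefficients over different charts: the subgroup generated by the
differences `(σ, α, v) - (σ, β, v')`, where `v'` is the image of `v` under the differential of the
change of charts at `σ`. The group of tropical chains is `chains` modulo this subgroup. -/
def chartRel (G : S.Coeff) (q : ℕ) : AddSubgroup (S.PreChain q) :=
  AddSubgroup.closure {c | ∃ (s s' : S.Cell q) (v : ExteriorAlgebra ℝ (Vec (S.N s.chart)))
    (v' : ExteriorAlgebra ℝ (Vec (S.N s'.chart))),
    s.toMap = s'.toMap ∧ v ∈ G s.chart s.base ∧ v' ∈ G s'.chart s'.base ∧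
    (∃ V A b, S.IsTransition s.chart s'.chart V A b ∧ s.base ∈ V ∧
      v' = ExteriorAlgebra.map (killCoords (refSed s'.pt) ∘ₗ linPart A) v) ∧
    c = DirectSum.of (fun s : S.Cell q => ExteriorAlgebra ℝ (Vec (S.N s.chart))) s v -
      DirectSum.of (fun s : S.Cell q => ExteriorAlgebra ℝ (Vec (S.N s.chart))) s' v'}

/-- Tropical cycles: chains whose boundary vanishes in the group of tropical chains. -/
def cycles (G : S.Coeff) : (q : ℕ) → AddSubgroup (S.PreChain q)
  | 0 => chains G 0
  | q + 1 => chains G (q + 1) ⊓ (chartRel G q).comap (S.boundary q)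

/-- Chains which are boundaries in the group of tropical chains. -/
def boundaries (G : S.Coeff) (q : ℕ) : AddSubgroup (S.PreChain q) :=
  (chains G (q + 1)).map (S.boundary q) ⊔ chartRel G q

/-- The tropical homology group `H_q(X; G)`. -/
abbrev Homology (G : S.Coeff) (q : ℕ) : Type _ :=
  cycles G q ⧸ (boundaries G q).addSubgroupOf (cycles G q)

/-- The class of a cycle. -/
def homologyClass {G : S.Coeff} {q : ℕ} (c : cycles G q) : Homology G q :=
  QuotientAddGroup.mk c

variable (S)

/-! ### Straight cycles -/

/-- A straight tropical `p`-cycle in `X`. -/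
structure StraightCycle (p : ℕ) where
  carrier : Set X
  /-- the set on which the weight function is defined -/
  dom : Set X
  weight : X → ℤ
  dom_open : ∃ O, IsOpen O ∧ dom = O ∩ carrier
  dom_dense : carrier ⊆ closure dom
  model : ∀ α, PolyComplex (S.N α) p
  modelWeight : ∀ α, Set (Vec (S.N α)) → ℤ
  balanced : ∀ α, (model α).IsBalanced (modelWeight α)
  isOpen_image : ∀ α, ∃ O, IsOpen O ∧ S.φ α '' (carrier ∩ S.U α) = O ∩ (model α).support
  weight_eq : ∀ α, ∀ D ∈ (model α).facets, ∀ x ∈ carrier ∩ S.U α,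
    S.φ α x ∈ toTrop '' intrinsicInterior ℝ D → x ∈ dom ∧ weight x = modelWeight α D

end TropicalSpace

/-- The geometric realisation of a finite simplicial complex with vertices in `Fin m`, as a
subset of the standard simplex. -/
def realization {m : ℕ} (faces : Finset (Finset (Fin m))) : Set (stdSimplex ℝ (Fin m)) :=
  {t | ∃ s ∈ faces, ∀ i, 0 < t i ↔ i ∈ s}

/-- A finite topological triangulation of a subset `Z` of a topological space, with ordered
vertices. -/
structure Triangulation {X : Type*} [TopologicalSpace X] (Z : Set X) where
  m : ℕ
  faces : Finset (Finset (Fin m))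
  nonempty_of_mem : ∀ s ∈ faces, s.Nonempty
  down_closed : ∀ s ∈ faces, ∀ t ⊆ s, t.Nonempty → t ∈ faces
  toMap : realization faces → X
  isEmbedding : IsEmbedding toMap
  range_eq : range toMap = Z

/-- The type of `p`-simplices of a triangulation. -/
abbrev Triangulation.Simplex {X : Type*} [TopologicalSpace X] {Z : Set X} (K : Triangulation Z)
    (p : ℕ) : Type := {s : Finset (Fin K.m) // s ∈ K.faces ∧ s.card = p + 1}

namespace TropicalSpace

variable {X : Type*} [TopologicalSpace X] {S : TropicalSpace X}

open Classical in
/-- A simplex in its chart, in the coordinates `u ∈ ℝ^p` of the standard simplex for which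
`u` has barycentric coordinates `(1 - ∑ u_i, u_1, …, u_p)`; extended by `0`. -/
def Cell.coordMap {p : ℕ} (s : S.Cell p) (u : Vec p) : Vec (S.N s.chart) :=
  if h : (Fin.cons (1 - ∑ i, u i) u : Fin (p + 1) → ℝ) ∈ stdSimplex ℝ (Fin (p + 1)) then
    finPart (S.φ s.chart (s.toMap ⟨_, h⟩))
  else 0

/-- `vol` is the volume element of the `p`-simplex `s` lying in a `p`-dimensional domain with
tangent space `L`: the generator `b_1 ∧ ⋯ ∧ b_p` of the top exterior power of the lattice
`L ∩ ℤ^N` which is positive for the orientation of `s` given by the order of its vertices. As `s` is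
injective, the orientation may be read off at any interior point at which `s` has
an invertible derivative. -/
def Cell.IsVolume {p : ℕ} (s : S.Cell p) (L : Submodule ℝ (Vec (S.N s.chart)))
    (vol : ExteriorAlgebra ℝ (Vec (S.N s.chart))) : Prop :=
  (∃ b : Fin p → Vec (S.N s.chart), LinearIndependent ℝ b ∧ (∀ i, IsIntegral (b i) ∧ b i ∈ L) ∧
    (∀ v ∈ L, IsIntegral v → ∃ m : Fin p → ℤ, v = ∑ i, (m i : ℝ) • b i) ∧
    vol = ExteriorAlgebra.ιMulti ℝ p b) ∧
  ∃ u : Vec p, (∀ i, 0 < u i) ∧ ∑ i, u i < 1 ∧ ∃ d : Vec p →L[ℝ] Vec (S.N s.chart),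
    HasFDerivAt s.coordMap d u ∧ ∃ c : ℝ, 0 < c ∧
      ExteriorAlgebra.ιMulti ℝ p (fun i => d (Pi.single i 1)) = c • vol

/-- `c` is the chain `∑ w(σ) Vol_σ σ` of a straight cycle `Z`, for a sufficiently fine
triangulation of `Z`: each `p`-simplex `σ` lies in a chart, in which its open simplex is contained in
the relative interior of a facet of `Z`, and is compatible with the combinatorial stratification
of `X`. -/
def IsFundamentalChain {p : ℕ} (Z : S.StraightCycle p) (c : S.PreChain p) : Prop :=
  ∃ (K : Triangulation Z.carrier) (cell : K.Simplex p → S.Cell p)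
    (vol : ∀ s, ExteriorAlgebra ℝ (Vec (S.N (cell s).chart))),
    (∀ s t, ∃ h : stdSimplex.map (s.1.orderEmbOfFin s.2.2) t ∈ realization K.faces,
      (cell s).toMap t = K.toMap ⟨_, h⟩) ∧
    (∀ s, ∃ D ∈ (Z.model (cell s).chart).facets,
      (∀ t ∈ openFace univ,
        S.φ (cell s).chart ((cell s).toMap t) ∈ toTrop '' intrinsicInterior ℝ D) ∧
      (cell s).IsVolume (vectorSpan ℝ D) (vol s)) ∧
    c = ∑ s, Z.weight (cell s).base •
      DirectSum.of (fun s : S.Cell p => ExteriorAlgebra ℝ (Vec (S.N s.chart))) (cell s) (vol s)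

variable (S)

/-- The group `H_{p,p}^{straight}(X)` of straight classes in `H_{p,p}(X) = H_p(X; F_p)`. -/
def straightClasses (p : ℕ) : AddSubgroup (Homology (S.FZ p) p) :=
  AddSubgroup.closure {γ | ∃ (Z : S.StraightCycle p) (c : cycles (S.FZ p) p),
    IsFundamentalChain Z (c : S.PreChain p) ∧ γ = homologyClass c}

/-! ### Wave cochains, the eigenwave and the cap product -/

/-- Wave cochains `C^r(X; W_1)`: functions on simplices with values in the wave tangent spaces,
compatible with changes of charts. -/
def IsWaveCochain {r : ℕ} (a : ∀ s : S.Cell r, Vec (S.N s.chart)) : Prop :=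
  (∀ s, a s ∈ (S.Y s.chart).waveSpace s.pt) ∧
  ∀ s s' : S.Cell r, s.toMap = s'.toMap → ∀ V A b,
    S.IsTransition s.chart s'.chart V A b → s.base ∈ V → a s' = linPart A (a s)

/-- A choice of a nearby mobile point `y_x` for each point `x`: it projects to `x` along the
divisorial directions, and lies in a neighbourhood of `x` in which the changes of charts are
integral affine. -/
def IsMobileLift (y : X → X) : Prop :=
  (∀ x α, x ∈ S.U α → refSed (S.φ α (y x)) = ∅ ∧
    ∀ i, S.φ α x i ≠ ⊥ → S.φ α (y x) i = S.φ α x i) ∧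
  ∀ x α β, x ∈ S.U α ∩ S.U β → ∃ V A b, S.IsTransition α β V A b ∧ x ∈ V ∧ y x ∈ V

variable {S}

/-- The vector `y_{τ(1)} - y_{τ(0)}` of a singular `1`-simplex `τ`. -/
def liftDiff (y : X → X) (s : S.Cell 1) : Vec (S.N s.chart) :=
  finPart (S.φ s.chart (y (s.toMap (stdSimplex.vertex 1)))) -
    finPart (S.φ s.chart (y (s.toMap (stdSimplex.vertex 0))))

/-- The coboundary of a wave `0`-cochain. -/
def coboundaryZero (e : ∀ s : S.Cell 0, Vec (S.N s.chart)) (s : S.Cell 1) :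
    Vec (S.N s.chart) :=
  fun i => e (s.face 0) i - e (s.face 1) i

/-- The wave cochain `a` represents the eigenwave class `φ ∈ H^1(X; W_1)`: it differs by
a coboundary from the cochain `τ ↦ y_{τ(1)} - y_{τ(0)}` for some choice of nearby mobile
points. -/
def RepresentsEigenwave (a : ∀ s : S.Cell 1, Vec (S.N s.chart)) : Prop :=
  S.IsWaveCochain a ∧ ∃ y, S.IsMobileLift y ∧
    ∃ e : ∀ s : S.Cell 0, Vec (S.N s.chart), S.IsWaveCochain e ∧
      ∀ s, a s = liftDiff y s + coboundaryZero e s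

/-- The cap product with a wave `1`-cochain:
`a ∩ (∑ β σ) = ∑ (a(σ_{01}) ∧ β) σ_{1 … q+1}`. The value `a(σ_{01})` is pushed to `σ` by the
inclusion of wave tangent spaces and projected along the divisorial directions, and
the wedge product is pushed to the face `σ_{1 … q+1}`. -/
def cap (a : ∀ s : S.Cell 1, Vec (S.N s.chart)) (q : ℕ) : S.PreChain (q + 1) →+ S.PreChain q :=
  DirectSum.toAddMonoid fun s =>
    ((DirectSum.of (fun s : S.Cell q => ExteriorAlgebra ℝ (Vec (S.N s.chart))) (s.face 0)).comp
      (s.face 0).project).comp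
      (AddMonoidHom.mulLeft
        (ExteriorAlgebra.ι ℝ (killCoords (refSed s.pt) (a s.firstEdge))))

end TropicalSpace

end TropGeom

end

noncomputable section

namespace TropGeom

/-! The eigenwave records displacements, and a straight cycle is flat. If a simplex `σ` of a fine
triangulation of a straight cycle lies in a facet `D` of dimension `p`, the displacement between two
of its vertices is tangent to `D`. Since `Vol_σ` spans the top exterior power of the tangent space
of `D`, wedging it with a tangent vector gives `0`. Thus the standard cochain `τ ↦ y_{τ(1)} -
y_{τ(0)}` already kills the fundamental chain, term by term (`cap_liftDiff_fundamentalChain`).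

At a vertex with infinite coordinates the displacement is taken between mobile lifts, which need not
lie on the cycle. A lift is determined by the vertex only modulo the infinite directions, so these
must be tangent to `D`. Regularity at infinity gives this by a dimension count
(`ker_killCoords_le_of_recession`, `IsRegularPoly.sub_mem_vectorSpan`).

Another cochain representing the eigenwave differs from the standard one by the coboundary of a wave
`0`-cochain `e`. Evaluating `e` at the first vertex of each simplex is a chain homotopy from that
correction to zero (`cap_coboundaryZero`).

The remaining work is to pass from fundamental chains to arbitrary representatives of the class: the
cap product must descend to homology. It anticommutes with the boundary because on each single
simplex the eigenwave is a difference of values at vertices (`cap_boundary`). It lands in `F_{p+1} ⊗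
ℝ` because a wave vector at a face of `σ` is tangent to every facet adjacent to the open simplex.
This rests on two facts about complexes: near each point of `𝕋^N` the complex is a cone invariant in
the infinite directions, and the set of adjacent tangent spaces is constant along a stratum
(`PolyComplex.eventually_tangentSpaces_eq`). Compatibility with changes of charts
(`capFaces_mem_chartRel`) holds because their differentials are locally constant on those tangent
spaces. -/

/-! ### Linear inequalities -/

/-- Farkas' lemma. -/
lemma farkas {ι V : Type*} [AddCommGroup V] [Module ℝ V] (s : Finset ι) :
    ∀ (h : ι → V →ₗ[ℝ] ℝ) (l : V →ₗ[ℝ] ℝ),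
      (∃ v, (∀ i ∈ s, h i v ≤ 0) ∧ l v < 0) ∨
        ∃ c : ι → ℝ, (∀ i ∈ s, 0 ≤ c i) ∧ ∀ v, l v = -∑ i ∈ s, c i * h i v := by
  classical
  induction s using Finset.induction_on with
  | empty =>
    intro h l
    by_cases hl : ∃ v, l v ≠ 0
    · obtain ⟨v, hv⟩ := hl
      left
      rcases lt_or_gt_of_ne hv with h0 | h0
      · exact ⟨v, by simp, h0⟩
      · exact ⟨-v, by simp, by simpa using h0⟩
    · push Not at hl
      exact Or.inr ⟨0, by simp, by simpa using hl⟩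
  | insert i₀ s hi ih =>
    intro h l
    rcases ih h l with ⟨v, hv, hl⟩ | ⟨c, hc, hl⟩
    · by_cases h0 : h i₀ v ≤ 0
      · exact Or.inl ⟨v, by simpa [h0] using hv, hl⟩
      push Not at h0
      -- Every form is composed with the projection onto `ker (h i₀)` along `v`; a solution for the
      -- new forms, once projected, also satisfies `h i₀ = 0`.
      rcases ih (fun i => h i - (h i v / h i₀ v) • h i₀) (l - (l v / h i₀ v) • h i₀) with
        ⟨w, hw, hlw⟩ | ⟨c, hc, hlc⟩
      · left
        refine ⟨w - (h i₀ w / h i₀ v) • v, ?_, ?_⟩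
        · intro i hmem
          rcases Finset.mem_insert.1 hmem with rfl | hmem
          · simp [h0.ne']
          · have := hw i hmem
            simp only [LinearMap.sub_apply, LinearMap.smul_apply, smul_eq_mul, map_sub,
              map_smul] at this ⊢
            calc _ = h i w - h i v / h i₀ v * h i₀ w := by ring
              _ ≤ 0 := this
        · simp only [LinearMap.sub_apply, LinearMap.smul_apply, smul_eq_mul, map_sub,
            map_smul] at hlw ⊢
          calc _ = l w - l v / h i₀ v * h i₀ w := by ring
              _ < 0 := hlw
      · right
        -- The multiplier of `h i₀` obtained by expanding the relation between the projected forms;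
        -- its sign comes from `l v < 0` and `h i v ≤ 0`.
        set d : ℝ := -(l v / h i₀ v + ∑ i ∈ s, c i * (h i v / h i₀ v)) with hd
        have hd0 : 0 ≤ d := by
          have h1 : l v / h i₀ v ≤ 0 := div_nonpos_of_nonpos_of_nonneg hl.le h0.le
          have h2 : ∑ i ∈ s, c i * (h i v / h i₀ v) ≤ 0 := Finset.sum_nonpos fun i hmem =>
            mul_nonpos_of_nonneg_of_nonpos (hc i hmem)
              (div_nonpos_of_nonpos_of_nonneg (hv i hmem) h0.le)
          linarith
        refine ⟨fun i => if i = i₀ then d else c i, ?_, ?_⟩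
        · intro i hmem
          by_cases hii : i = i₀
          · simpa [hii] using hd0
          · simpa [hii] using hc i ((Finset.mem_insert.1 hmem).resolve_left hii)
        · intro x
          have := hlc x
          rw [Finset.sum_insert hi]
          have hs : ∑ i ∈ s, (if i = i₀ then d else c i) * h i x = ∑ i ∈ s, c i * h i x :=
            Finset.sum_congr rfl fun i hmem => by
              rw [if_neg]
              rintro rfl
              exact hi hmem
          simp only [LinearMap.sub_apply, LinearMap.smul_apply, smul_eq_mul, mul_sub,
            Finset.sum_sub_distrib] at this
          rw [hs]
          simp only [↓reduceIte]
          rw [hd]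
          have h3 : ∑ i ∈ s, c i * (h i v / h i₀ v * h i₀ x) =
              (∑ i ∈ s, c i * (h i v / h i₀ v)) * h i₀ x := by
            rw [Finset.sum_mul]
            exact Finset.sum_congr rfl fun i _ => by ring
          rw [h3] at this
          linear_combination this
    · right
      refine ⟨fun i => if i = i₀ then 0 else c i, ?_, ?_⟩
      · intro i hmem
        by_cases hii : i = i₀
        · simp [hii]
        · simpa [hii] using hc i ((Finset.mem_insert.1 hmem).resolve_left hii)
      · intro x
        rw [Finset.sum_insert hi, hl x]
        have hs : ∑ i ∈ s, (if i = i₀ then 0 else c i) * h i x = ∑ i ∈ s, c i * h i x :=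
          Finset.sum_congr rfl fun i hmem => by
            rw [if_neg]
            rintro rfl
            exact hi hmem
        rw [hs]
        simp

/-- A linear form that is unbounded below on a set on which finitely many forms are bounded above
is negative on some direction in which these forms are non-positive. -/
lemma exists_direction {ι V : Type*} [AddCommGroup V] [Module ℝ V] (s : Finset ι)
    (h : ι → V →ₗ[ℝ] ℝ) (l : V →ₗ[ℝ] ℝ) (C : ℝ)
    (hx : ∀ K : ℝ, ∃ x, (∀ i ∈ s, h i x ≤ C) ∧ l x < -K) :
    ∃ v, (∀ i ∈ s, h i v ≤ 0) ∧ l v < 0 := by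
  rcases farkas s h l with h1 | ⟨c, hc, hl⟩
  · exact h1
  · exfalso
    -- A relation `l = -∑ c i * h i` would bound `l` below by `-∑ c i * C`.
    obtain ⟨x, hxs, hxl⟩ := hx (∑ i ∈ s, c i * C)
    have : ∑ i ∈ s, c i * h i x ≤ ∑ i ∈ s, c i * C :=
      Finset.sum_le_sum fun i hi => mul_le_mul_of_nonneg_left (hxs i hi) (hc i hi)
    rw [hl x] at hxl
    linarith

/-- The linear form on `ℝ^N` with integer coefficients `h`. -/
def intForm {N : ℕ} (h : Fin N → ℤ) : Vec N →ₗ[ℝ] ℝ := ∑ i, (h i : ℝ) • LinearMap.proj i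

lemma intForm_apply {N : ℕ} (h : Fin N → ℤ) (x : Vec N) :
    intForm h x = ∑ i, (h i : ℝ) * x i := by
  simp [intForm]

lemma mem_halfSpaces {N : ℕ} {H : Finset ((Fin N → ℤ) × ℝ)} {x : Vec N} :
    x ∈ halfSpaces H ↔ ∀ h ∈ H, intForm h.1 x ≤ h.2 := by
  simp [halfSpaces, intForm_apply]

lemma isClosed_halfSpaces {N : ℕ} (H : Finset ((Fin N → ℤ) × ℝ)) :
    IsClosed (halfSpaces H) := by
  have : halfSpaces H = ⋂ h ∈ H, {x : Vec N | ∑ i, (h.1 i : ℝ) * x i ≤ h.2} := by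
    ext x; simp [halfSpaces]
  rw [this]
  exact isClosed_biInter fun h _ => isClosed_le (by fun_prop) continuous_const

lemma convex_halfSpaces {N : ℕ} (H : Finset ((Fin N → ℤ) × ℝ)) :
    Convex ℝ (halfSpaces H) := by
  intro x hx y hy a b ha hb hab
  rw [mem_halfSpaces] at *
  intro h hh
  have h1 := mul_le_mul_of_nonneg_left (hx h hh) ha
  have h2 := mul_le_mul_of_nonneg_left (hy h hh) hb
  simp only [map_add, map_smul, smul_eq_mul]
  calc _ ≤ a * h.2 + b * h.2 := add_le_add h1 h2
    _ = h.2 := by rw [← add_mul, hab, one_mul]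

/-! ### Neighbourhoods in `𝕋^N` -/

section Topology

variable {N : ℕ}

lemma continuous_toTrop : Continuous (toTrop : Vec N → TropVec N) :=
  continuous_pi fun i => WithBot.continuous_coe.comp (continuous_apply i)

lemma finPart_of_bot {y : TropVec N} {i : Fin N} (h : y i = ⊥) : finPart y i = 0 := by
  simp [finPart, h]

lemma coe_finPart {y : TropVec N} {i : Fin N} (h : y i ≠ ⊥) : (finPart y i : WithBot ℝ) = y i := by
  obtain ⟨r, hr⟩ := WithBot.ne_bot_iff_exists.1 h
  simp [finPart, ← hr]

/-- Only mobile points near `y` matter. Writing them as `toTrop x = z` keeps the filter `𝓝 y`; the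
condition is vacuous for `z` with an infinite coordinate. -/
lemma eventually_near (y : TropVec N) (K : ℝ) {ε : ℝ} (hε : 0 < ε) :
    ∀ᶠ z in 𝓝 y, ∀ x, toTrop x = z →
      (∀ i, y i = ⊥ → x i < K) ∧ ∀ i, y i ≠ ⊥ → |x i - finPart y i| < ε := by
  have key : ∀ i, ∀ᶠ z in 𝓝 y, ∀ x, toTrop x = z →
      (y i = ⊥ → x i < K) ∧ (y i ≠ ⊥ → |x i - finPart y i| < ε) := by
    intro i
    by_cases hi : y i = ⊥
    · have h1 : ∀ᶠ w in 𝓝 (y i), w < (K : WithBot ℝ) := by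
        rw [hi]
        exact Iio_mem_nhds (WithBot.bot_lt_coe K)
      filter_upwards [(continuous_apply i).continuousAt.eventually h1] with z hz x hx
      refine ⟨fun _ => ?_, fun h => absurd hi h⟩
      rw [← hx] at hz
      exact WithBot.coe_lt_coe.1 hz
    · have h1 : ∀ᶠ w in 𝓝 (y i), w ∈ Ioo ((finPart y i - ε : ℝ) : WithBot ℝ)
          ((finPart y i + ε : ℝ) : WithBot ℝ) := by
        rw [← coe_finPart hi]
        exact Ioo_mem_nhds (WithBot.coe_lt_coe.2 (by linarith)) (WithBot.coe_lt_coe.2 (by linarith))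
      filter_upwards [(continuous_apply i).continuousAt.eventually h1] with z hz x hx
      refine ⟨fun h => absurd h hi, fun _ => ?_⟩
      rw [← hx] at hz
      have h2 := WithBot.coe_lt_coe.1 hz.1
      have h3 := WithBot.coe_lt_coe.1 hz.2
      rw [abs_lt]
      constructor <;> linarith
  filter_upwards [eventually_all.2 key] with z hz x hx
  exact ⟨fun i => (hz i x hx).1, fun i => (hz i x hx).2⟩

lemma eventually_refSed_subset (y : TropVec N) : ∀ᶠ z in 𝓝 y, refSed z ⊆ refSed y := by
  have key : ∀ i, ∀ᶠ z in 𝓝 y, z i = ⊥ → y i = ⊥ := by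
    intro i
    by_cases hi : y i = ⊥
    · exact Eventually.of_forall fun _ _ => hi
    · filter_upwards [(continuous_apply i).continuousAt.eventually (isOpen_ne.mem_nhds hi)]
        with z hz h
      exact absurd h hz
  filter_upwards [eventually_all.2 key] with z hz i hi using hz i hi

lemma tendsto_toTrop {ι : Type*} {l : Filter ι} {f : ι → Vec N} {y : TropVec N}
    (h1 : ∀ i, y i = ⊥ → Tendsto (fun t => f t i) l atBot)
    (h2 : ∀ i, y i ≠ ⊥ → Tendsto (fun t => f t i) l (𝓝 (finPart y i))) :
    Tendsto (fun t => toTrop (f t)) l (𝓝 y) := by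
  refine tendsto_pi_nhds.2 fun i => ?_
  by_cases hi : y i = ⊥
  · rw [hi]
    refine (nhds_bot_basis (α := WithBot ℝ)).tendsto_right_iff.2 fun a ha => ?_
    obtain ⟨r, rfl⟩ := WithBot.ne_bot_iff_exists.1 (ne_of_gt ha)
    filter_upwards [(h1 i hi).eventually_lt_atBot r] with t ht
    exact WithBot.coe_lt_coe.2 ht
  · rw [← coe_finPart hi]
    exact (WithBot.continuous_coe.tendsto _).comp (h2 i hi)

lemma exists_near {D : Set (Vec N)} {y : TropVec N} (hy : y ∈ domain D) {P : TropVec N → Prop}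
    (hP : ∀ᶠ z in 𝓝 y, P z) : ∃ x ∈ D, P (toTrop x) := by
  obtain ⟨z, ⟨x, hx, rfl⟩, hz⟩ := ((mem_closure_iff_frequently.1 hy).and_eventually hP).exists
  exact ⟨x, hx, hz⟩

lemma mobileShift_of_bot {y : TropVec N} {i : Fin N} (h : y i = ⊥) (M : ℝ) :
    PolyComplex.mobileShift y M i = -M := by
  simp [PolyComplex.mobileShift, h]

lemma mobileShift_of_ne_bot {y : TropVec N} {i : Fin N} (h : y i ≠ ⊥) (M : ℝ) :
    PolyComplex.mobileShift y M i = finPart y i := by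
  obtain ⟨r, hr⟩ := WithBot.ne_bot_iff_exists.1 h
  simp [PolyComplex.mobileShift, finPart, ← hr]

lemma tendsto_mobileShift_add (y : TropVec N) {f : ℝ → Vec N} (hf : Tendsto f atTop (𝓝 0)) :
    Tendsto (fun M => toTrop (PolyComplex.mobileShift y M + f M)) atTop (𝓝 y) := by
  have hi : ∀ i, Tendsto (fun M => f M i) atTop (𝓝 0) := fun i =>
    ((continuous_apply i).tendsto (0 : Vec N)).comp hf
  refine tendsto_toTrop (fun i h => ?_) (fun i h => ?_)
  · simp only [Pi.add_apply, mobileShift_of_bot h]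
    exact tendsto_neg_atTop_atBot.atBot_add (hi i)
  · simp only [Pi.add_apply, mobileShift_of_ne_bot h]
    simpa using (hi i).const_add (finPart y i)

lemma tendsto_mobileShift (y : TropVec N) :
    Tendsto (fun M => toTrop (PolyComplex.mobileShift y M)) atTop (𝓝 y) := by
  simpa using tendsto_mobileShift_add y (f := fun _ => 0) tendsto_const_nhds

end Topology

/-! ### Polyhedra that are regular at infinity -/

/-- A non-empty polyhedron all of whose faces are regular at infinity. -/
structure IsRegularPoly {N : ℕ} (D : Set (Vec N)) : Prop where
  isRatPoly : IsRatPoly D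
  nonempty : D.Nonempty
  regular : ∀ E, IsFace E D → RegularAtInfinity E

lemma PolyComplex.isRegularPoly {N n : ℕ} (Y : PolyComplex N n) {D : Set (Vec N)}
    (hD : D ∈ Y.facets) : IsRegularPoly D :=
  ⟨Y.isRatPoly D hD, Y.nonempty D hD, Y.regular D hD⟩

section Polyhedra

variable {N : ℕ}

/-- Along points of the polyhedron tending to `y` the defining forms and the finite coordinates stay
bounded, while an infinite coordinate is unbounded below. Farkas' lemma turns this into a recession
direction for each infinite coordinate. -/
lemma exists_recession {H : Finset ((Fin N → ℤ) × ℝ)} {y : TropVec N}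
    (hy : y ∈ domain (halfSpaces H)) :
    ∃ v : Vec N, (∀ h ∈ H, intForm h.1 v ≤ 0) ∧ (∀ i, y i = ⊥ → v i < 0) ∧
      ∀ i, y i ≠ ⊥ → v i = 0 := by
  classical
  -- the conditions: half-spaces, signs of coordinates
  let F : ((Fin N → ℤ) × ℝ) ⊕ (Fin N ⊕ Fin N) → Vec N →ₗ[ℝ] ℝ :=
    Sum.elim (fun h => intForm h.1) (Sum.elim (fun i => LinearMap.proj i)
      (fun i => -LinearMap.proj i))
  let s : Finset (((Fin N → ℤ) × ℝ) ⊕ (Fin N ⊕ Fin N)) :=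
    H.disjSum (Finset.univ.disjSum (Finset.univ.filter fun i => y i ≠ ⊥))
  have hs : ∀ v C, (∀ k ∈ s, F k v ≤ C) ↔ (∀ h ∈ H, intForm h.1 v ≤ C) ∧ (∀ i, v i ≤ C) ∧
      ∀ i, y i ≠ ⊥ → -v i ≤ C := by
    intro v C
    simp [s, F]
  obtain ⟨C, hC⟩ : ∃ C : ℝ, (∀ h ∈ H, h.2 ≤ C) ∧ ∀ i, |finPart y i| + 1 ≤ C := by
    obtain ⟨C1, h1⟩ := (H.image Prod.snd).bddAbove
    obtain ⟨C2, h2⟩ := (Finset.univ.image fun i => |finPart y i| + 1).bddAbove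
    refine ⟨max C1 C2, fun h hh => le_max_of_le_left (h1 ?_), fun i => le_max_of_le_right (h2 ?_)⟩
    · exact Finset.mem_coe.2 (Finset.mem_image_of_mem _ hh)
    · exact Finset.mem_coe.2 (Finset.mem_image_of_mem _ (Finset.mem_univ i))
  have hv : ∀ i, ∃ v : Vec N, (∀ k ∈ s, F k v ≤ 0) ∧ (y i = ⊥ → v i < 0) := by
    intro i
    by_cases hi : y i = ⊥
    · obtain ⟨v, h1, h2⟩ := exists_direction s F (LinearMap.proj i) C (by
        intro K
        -- The bound `-K` serves the chosen coordinate; `-|C|` keeps all infinite coordinates below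
        -- `C`.
        obtain ⟨x, hx, hn⟩ := exists_near hy (eventually_near y (min (-K) (-|C|)) one_pos)
        obtain ⟨hb, hf⟩ := hn x rfl
        refine ⟨x, (hs x C).2 ⟨fun h hh => ?_, fun j => ?_, fun j hj => ?_⟩, ?_⟩
        · exact (mem_halfSpaces.1 hx h hh).trans (hC.1 h hh)
        · by_cases hj : y j = ⊥
          · exact ((hb j hj).le.trans (min_le_right _ _)).trans (neg_abs_le C)
          · have := abs_lt.1 (hf j hj)
            have h3 := hC.2 j
            have h4 := le_abs_self (finPart y j)
            linarith
        · have := abs_lt.1 (hf j hj)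
          have h3 := hC.2 j
          have h4 := neg_le_abs (finPart y j)
          linarith
        · exact (hb i hi).trans_le (min_le_left _ _))
      exact ⟨v, h1, fun _ => h2⟩
    · exact ⟨0, by simp, fun h => absurd h hi⟩
  choose v hv1 hv2 using hv
  -- Each summand satisfies all the weak inequalities, and the `i`-th one is strict at the infinite
  -- coordinate `i`.
  refine ⟨∑ i, v i, fun h hh => ?_, fun i hi => ?_, fun i hi => ?_⟩
  · rw [map_sum]
    exact Finset.sum_nonpos fun i _ => ((hs _ _).1 (hv1 i)).1 h hh
  · rw [Finset.sum_apply]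
    refine Finset.sum_neg' (fun j _ => ((hs _ _).1 (hv1 j)).2.1 i) ⟨i, Finset.mem_univ _, hv2 i hi⟩
  · rw [Finset.sum_apply]
    refine Finset.sum_eq_zero fun j _ => le_antisymm (((hs _ _).1 (hv1 j)).2.1 i) ?_
    have := ((hs _ _).1 (hv1 j)).2.2 i hi
    linarith

lemma killCoords_apply (I : Set (Fin N)) (v : Vec N) (i : Fin N) :
    killCoords I v i = open Classical in if i ∈ I then 0 else v i := by
  simp only [killCoords, LinearMap.pi_apply]
  split_ifs <;> simp

lemma killCoords_of_mem {I : Set (Fin N)} {i : Fin N} (h : i ∈ I) (v : Vec N) :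
    killCoords I v i = 0 := by simp [killCoords_apply, h]

lemma killCoords_of_notMem {I : Set (Fin N)} {i : Fin N} (h : i ∉ I) (v : Vec N) :
    killCoords I v i = v i := by simp [killCoords_apply, h]

lemma killCoords_killCoords {I J : Set (Fin N)} (h : I ⊆ J) (v : Vec N) :
    killCoords J (killCoords I v) = killCoords J v := by
  funext i
  by_cases hi : i ∈ J
  · simp [killCoords_of_mem hi]
  · rw [killCoords_of_notMem hi, killCoords_of_notMem hi, killCoords_of_notMem fun h' => hi (h h')]

lemma mem_ker_killCoords {I : Set (Fin N)} {v : Vec N} :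
    v ∈ LinearMap.ker (killCoords I) ↔ ∀ i, i ∉ I → v i = 0 := by
  rw [LinearMap.mem_ker]
  constructor
  · intro h i hi
    rw [← killCoords_of_notMem hi v, h]; rfl
  · intro h
    funext i
    by_cases hi : i ∈ I
    · simp [killCoords_of_mem hi]
    · simp [killCoords_of_notMem hi, h i hi]

lemma finrank_ker_killCoords (I : Set (Fin N)) :
    Module.finrank ℝ (LinearMap.ker (killCoords I)) = I.ncard := by
  classical
  have e : LinearMap.ker (killCoords I) ≃ₗ[ℝ] (I → ℝ) :=
    { toFun := fun v i => v.1 i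
      map_add' := fun _ _ => rfl
      map_smul' := fun _ _ => rfl
      invFun := fun w => ⟨fun i => if h : i ∈ I then w ⟨i, h⟩ else 0,
        mem_ker_killCoords.2 fun i hi => by simp [hi]⟩
      left_inv := fun v => by
        ext i
        by_cases hi : i ∈ I
        · simp [hi]
        · simp [hi, mem_ker_killCoords.1 v.2 i hi]
      right_inv := fun w => by
        ext i
        simp }
  rw [e.finrank_eq, Module.finrank_fintype_fun_eq_card, ← Nat.card_eq_fintype_card]
  rfl

end Polyhedra

/-! ### Consequences of regularity: tangency of the infinite directions and local cones. -/

section RegularPoly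

variable {N : ℕ}

/-- The ray `x + s • v` converges to the point with the infinite coordinates of `y` and the other
coordinates of `x`. -/
lemma killCoords_mem_sedPart {E : Set (Vec N)} {y : TropVec N} {v : Vec N}
    (hv : ∀ x ∈ E, ∀ s : ℝ, 0 ≤ s → x + s • v ∈ E) (hneg : ∀ i, y i = ⊥ → v i < 0)
    (hzero : ∀ i, y i ≠ ⊥ → v i = 0) {x : Vec N} (hx : x ∈ E) :
    killCoords (refSed y) x ∈ sedPart (refSed y) E := by
  classical
  let z : TropVec N := fun i => if y i = ⊥ then ⊥ else (x i : WithBot ℝ)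
  have hz : ∀ i, z i = ⊥ ↔ y i = ⊥ := by
    intro i; by_cases h : y i = ⊥ <;> simp [z, h]
  refine ⟨z, ⟨?_, ?_⟩, ?_⟩
  · have ht : Tendsto (fun s : ℝ => toTrop (x + s • v)) atTop (𝓝 z) := by
      refine tendsto_toTrop (fun i hi => ?_) (fun i hi => ?_)
      · have := hneg i ((hz i).1 hi)
        simpa using tendsto_atBot_add_const_left atTop (x i)
          (tendsto_id.atTop_mul_const_of_neg this)
      · have h1 : v i = 0 := hzero i fun h => hi ((hz i).2 h)
        have h2 : finPart z i = x i := by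
          have : y i ≠ ⊥ := fun h => hi ((hz i).2 h)
          simp [finPart, z, this]
        simp [h1, h2]
    refine mem_closure_of_tendsto ht ?_
    filter_upwards [eventually_ge_atTop 0] with s hs
    exact mem_image_of_mem _ (hv x hx s hs)
  · ext i; exact hz i
  · funext i
    by_cases h : y i = ⊥
    · rw [killCoords_of_mem (show i ∈ refSed y from h)]
      simp [finPart, z, h]
    · rw [killCoords_of_notMem (show i ∉ refSed y from h)]
      simp [finPart, z, h]

lemma finrank_map_add_finrank_inf {V W : Type*} [AddCommGroup V] [Module ℝ V]
    [FiniteDimensional ℝ V] [AddCommGroup W] [Module ℝ W] (f : V →ₗ[ℝ] W) (L : Submodule ℝ V) :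
    Module.finrank ℝ (L.map f) + Module.finrank ℝ (L ⊓ LinearMap.ker f : Submodule ℝ V) =
      Module.finrank ℝ L := by
  rw [← LinearMap.finrank_range_add_finrank_ker (f.domRestrict L), LinearMap.range_domRestrict,
    LinearMap.ker_domRestrict, ← Submodule.map_comap_subtype, Submodule.finrank_map_subtype_eq]

/-- A dimension count. The projection of the tangent space of `E` lies in that of the part at
infinity, whose dimension is `dim E - |I|` by regularity. So the projection has kernel of dimension
at least `|I|` on the tangent space of `E`, and this is the dimension of its full kernel. -/
lemma ker_killCoords_le_of_recession {E : Set (Vec N)} (hE : E.Nonempty)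
    (hreg : RegularAtInfinity E) {y : TropVec N} {v : Vec N}
    (hv : ∀ x ∈ E, ∀ s : ℝ, 0 ≤ s → x + s • v ∈ E) (hneg : ∀ i, y i = ⊥ → v i < 0)
    (hzero : ∀ i, y i ≠ ⊥ → v i = 0) :
    LinearMap.ker (killCoords (refSed y)) ≤ vectorSpan ℝ E := by
  obtain ⟨x, hx⟩ := hE
  have h1 := (hreg (refSed y) ⟨_, killCoords_mem_sedPart hv hneg hzero hx⟩).2
  have h2 : (vectorSpan ℝ E).map (killCoords (refSed y)) ≤
      vectorSpan ℝ (sedPart (refSed y) E) := by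
    have := AffineMap.map_vectorSpan (k := ℝ)
      (killCoords (refSed y)).toAffineMap (s := E)
    rw [LinearMap.toAffineMap_linear] at this
    rw [this]
    refine vectorSpan_mono ℝ ?_
    rintro _ ⟨x, hx, rfl⟩
    exact killCoords_mem_sedPart hv hneg hzero hx
  have h3 := Submodule.finrank_mono h2
  have h4 : Module.finrank ℝ ((vectorSpan ℝ E).map (killCoords (refSed y))) + Module.finrank ℝ
      (vectorSpan ℝ E ⊓ LinearMap.ker (killCoords (refSed y)) : Submodule ℝ (Vec N)) =
      Module.finrank ℝ (vectorSpan ℝ E) := finrank_map_add_finrank_inf _ _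
  change Module.finrank ℝ (vectorSpan ℝ (sedPart (refSed y) E)) + (refSed y).ncard =
    Module.finrank ℝ (vectorSpan ℝ E) at h1
  have h7 : Module.finrank ℝ (LinearMap.ker (killCoords (refSed y))) ≤ Module.finrank ℝ
      (vectorSpan ℝ E ⊓ LinearMap.ker (killCoords (refSed y)) : Submodule ℝ (Vec N)) := by
    rw [finrank_ker_killCoords]
    refine le_of_add_le_add_left (a := Module.finrank ℝ (vectorSpan ℝ (sedPart (refSed y) E))) ?_
    rw [h1, ← h4]
    exact Nat.add_le_add_right h3 _
  have h6 : vectorSpan ℝ E ⊓ LinearMap.ker (killCoords (refSed y)) =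
      LinearMap.ker (killCoords (refSed y)) :=
    Submodule.eq_of_le_of_finrank_le inf_le_right h7
  exact h6 ▸ inf_le_left

/-- A half-space whose wall misses `D` can be dropped: a point violating only that inequality,
joined to a point of `D`, would give a segment crossing the wall inside `D`. -/
lemma exists_irredundant {D : Set (Vec N)} (hD : D.Nonempty) (H : Finset ((Fin N → ℤ) × ℝ)) :
    D = halfSpaces H → ∃ H', D = halfSpaces H' ∧ ∀ h ∈ H', ∃ x ∈ D, intForm h.1 x = h.2 := by
  classical
  induction H using Finset.strongInduction with
  | H H ih =>
    intro hH
    by_cases ht : ∀ h ∈ H, ∃ x ∈ D, intForm h.1 x = h.2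
    · exact ⟨H, hH, ht⟩
    push Not at ht
    obtain ⟨h, hh, hx⟩ := ht
    refine ih (H.erase h) (Finset.erase_ssubset hh) (Subset.antisymm ?_ ?_)
    · intro x hxD
      rw [hH, mem_halfSpaces] at hxD
      exact mem_halfSpaces.2 fun k hk => hxD k (Finset.mem_of_mem_erase hk)
    · intro x hxE
      obtain ⟨d, hd⟩ := hD
      by_contra hxD
      have hd' : intForm h.1 d < h.2 :=
        lt_of_le_of_ne (mem_halfSpaces.1 (hH ▸ hd) h hh) (hx d hd)
      have hxh : h.2 < intForm h.1 x := by
        by_contra hle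
        push Not at hle
        apply hxD
        rw [hH, mem_halfSpaces]
        intro k hk
        by_cases hkh : k = h
        · exact hkh ▸ hle
        · exact mem_halfSpaces.1 hxE k (Finset.mem_erase.2 ⟨hkh, hk⟩)
      set r := intForm h.1 x - intForm h.1 d with hr
      have hr0 : 0 < r := by linarith
      set t := (h.2 - intForm h.1 d) / r with ht
      have ht0 : 0 ≤ t := div_nonneg (by linarith) hr0.le
      have ht1 : t ≤ 1 := (div_le_one hr0).2 (by linarith)
      have hz : (1 - t) • d + t • x ∈ halfSpaces (H.erase h) :=
        convex_halfSpaces _ (mem_halfSpaces.2 fun k hk =>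
          mem_halfSpaces.1 (hH ▸ hd) k (Finset.mem_of_mem_erase hk)) hxE (by linarith) ht0
          (by linarith)
      have hzh : intForm h.1 ((1 - t) • d + t • x) = h.2 := by
        simp only [map_add, map_smul, smul_eq_mul]
        have : t * r = h.2 - intForm h.1 d := div_mul_cancel₀ _ hr0.ne'
        rw [hr] at this
        linear_combination this
      refine hx _ ?_ hzh
      rw [hH, mem_halfSpaces]
      intro k hk
      by_cases hkh : k = h
      · exact hkh ▸ hzh.le
      · exact mem_halfSpaces.1 hz k (Finset.mem_erase.2 ⟨hkh, hk⟩)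

lemma intForm_single (h : Fin N → ℤ) (i : Fin N) (t : ℝ) :
    intForm h (Pi.single i t) = h i * t := by
  simp [intForm_apply, Pi.single_apply]

/-- If a tight inequality had a negative coefficient at an infinite coordinate `i`, a recession
direction pushed along `-e_i` would hit a wall `h₁` with `h₁.1 i < 0`. The resulting direction is a
recession direction of the face of `D` on this wall, with the same signs at infinity. Regularity of
that face makes `e_i` tangent to it, so the form of `h₁` vanishes on `e_i`, a contradiction. -/
lemma IsRegularPoly.exists_nonneg {D : Set (Vec N)} (hD : IsRegularPoly D) {y : TropVec N}
    (hy : y ∈ domain D) :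
    ∃ H, D = halfSpaces H ∧ ∀ h ∈ H, ∀ i, y i = ⊥ → 0 ≤ h.1 i := by
  classical
  obtain ⟨H₀, hH₀⟩ := hD.isRatPoly
  obtain ⟨H, hH, htight⟩ := exists_irredundant hD.nonempty H₀ hH₀
  refine ⟨H, hH, ?_⟩
  by_contra! hcon
  obtain ⟨h₀, hh₀, i, hi, hneg⟩ := hcon
  obtain ⟨v, hv, hvneg, hvzero⟩ := exists_recession (hH ▸ hy)
  -- the first wall met by the ray from `v` in the direction `-e_i`
  obtain ⟨h₁, hh₁, hmin⟩ := Finset.exists_min_image (H.filter fun h => h.1 i < 0)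
    (fun h => intForm h.1 v / h.1 i) ⟨h₀, Finset.mem_filter.2 ⟨hh₀, hneg⟩⟩
  obtain ⟨hh₁, hneg₁⟩ := Finset.mem_filter.1 hh₁
  have hneg₁' : (h₁.1 i : ℝ) < 0 := by exact_mod_cast hneg₁
  set t := intForm h₁.1 v / h₁.1 i with ht
  have ht0 : 0 ≤ t := div_nonneg_of_nonpos (hv h₁ hh₁) hneg₁'.le
  set w : Vec N := v - Pi.single i t with hw
  have hwH : ∀ h ∈ H, intForm h.1 w ≤ 0 := by
    intro h hh
    rw [hw, map_sub, intForm_single]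
    have h1 := hv h hh
    by_cases hs : h.1 i < 0
    · have hs' : (h.1 i : ℝ) < 0 := by exact_mod_cast hs
      have := hmin h (Finset.mem_filter.2 ⟨hh, hs⟩)
      rw [le_div_iff_of_neg hs'] at this
      linarith
    · have : (0 : ℝ) ≤ h.1 i := by exact_mod_cast not_lt.1 hs
      have := mul_nonneg this ht0
      linarith
  have hw₁ : intForm h₁.1 w = 0 := by
    rw [hw, map_sub, intForm_single, ht, mul_div_cancel₀ _ hneg₁'.ne, sub_self]
  set E : Set (Vec N) := {x | x ∈ D ∧ ∀ h ∈ ({h₁} : Finset _), ∑ j, (h.1 j : ℝ) * x j = h.2}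
    with hE
  have hEmem : ∀ x, x ∈ E ↔ x ∈ D ∧ intForm h₁.1 x = h₁.2 := by
    intro x; simp [hE, intForm_apply]
  have hEne : E.Nonempty := by
    obtain ⟨x, hx, hxh⟩ := htight h₁ hh₁
    exact ⟨x, (hEmem x).2 ⟨hx, hxh⟩⟩
  have hface : IsFace E D := ⟨hEne, H, hH, {h₁}, by simpa using hh₁, rfl⟩
  have hker := ker_killCoords_le_of_recession hEne (hD.regular E hface) (y := y) (v := w)
    (by
      intro x hx s hs
      rw [hEmem] at hx ⊢
      refine ⟨?_, ?_⟩
      · rw [hH, mem_halfSpaces] at hx ⊢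
        intro h hh
        have h1 := hx.1 h hh
        have h2 := mul_nonpos_of_nonneg_of_nonpos hs (hwH h hh)
        simp only [map_add, map_smul, smul_eq_mul]
        linarith
      · simp [hx.2, hw₁])
    (by
      intro j hj
      have := hvneg j hj
      rw [hw, Pi.sub_apply]
      by_cases hji : j = i
      · subst hji; simp; linarith
      · simpa [hji] using this)
    (by
      intro j hj
      have hji : j ≠ i := by rintro rfl; exact hj hi
      simp [hw, hji, hvzero j hj])
  have hle : vectorSpan ℝ E ≤ LinearMap.ker (intForm h₁.1) := by
    obtain ⟨x₀, hx₀⟩ := hEne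
    rw [vectorSpan_eq_span_vsub_set_right ℝ hx₀, Submodule.span_le]
    rintro _ ⟨x, hx, rfl⟩
    simp [((hEmem x).1 hx).2, ((hEmem x₀).1 hx₀).2]
  have hmem : (Pi.single i (1 : ℝ) : Vec N) ∈ LinearMap.ker (killCoords (refSed y)) :=
    mem_ker_killCoords.2 fun j hj => by
      have hji : j ≠ i := by rintro rfl; exact hj hi
      simp [hji]
  have := hle (hker hmem)
  rw [LinearMap.mem_ker, intForm_single, mul_one] at this
  exact hneg₁'.ne this

lemma intForm_sub_le (h : Fin N → ℤ) {y : TropVec N} {x : Vec N} {ε : ℝ}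
    (hε : ∀ i, y i ≠ ⊥ → |x i - finPart y i| < ε) (hnn : ∀ i, y i = ⊥ → 0 ≤ h i)
    (hneg : ∀ i, y i = ⊥ → x i < 0) (i : Fin N) :
    (h i : ℝ) * (x i - finPart y i) ≤ |(h i : ℝ)| * ε ∨
      y i = ⊥ ∧ (h i : ℝ) * (x i - finPart y i) ≤ 0 := by
  by_cases hi : y i = ⊥
  · right
    refine ⟨hi, ?_⟩
    rw [finPart_of_bot hi, sub_zero]
    exact mul_nonpos_of_nonneg_of_nonpos (by exact_mod_cast hnn i hi) (hneg i hi).le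
  · left
    calc _ ≤ |(h i : ℝ) * (x i - finPart y i)| := le_abs_self _
      _ = |(h i : ℝ)| * |x i - finPart y i| := abs_mul _ _
      _ ≤ _ := mul_le_mul_of_nonneg_left (hε i hi).le (abs_nonneg _)

/-- A linear form with non-negative coefficients in the infinite directions is bounded above near a
point of `𝕋^N`; if one of these coefficients is positive, it tends to `-∞`. -/
lemma eventually_intForm_lt (h : Fin N → ℤ) {y : TropVec N} (hnn : ∀ i, y i = ⊥ → 0 ≤ h i)
    {a : ℝ} (ha : intForm h (finPart y) < a ∨ ∃ i, y i = ⊥ ∧ h i ≠ 0) :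
    ∀ᶠ z in 𝓝 y, ∀ x, toTrop x = z → intForm h x < a := by
  set S : ℝ := ∑ i, |(h i : ℝ)| with hS
  have hS0 : 0 ≤ S := Finset.sum_nonneg fun i _ => abs_nonneg _
  have hsum : ∀ x, intForm h x - intForm h (finPart y) =
      ∑ i, (h i : ℝ) * (x i - finPart y i) := by
    intro x; simp [intForm_apply, mul_sub]
  rcases ha with ha | ⟨i₀, hi₀, hne⟩
  -- The finite coordinates contribute at most `S * ε`; the `+ 1` makes this smaller than the gap
  -- and avoids division by zero.
  · set ε : ℝ := (a - intForm h (finPart y)) / (S + 1) with hε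
    have hε0 : 0 < ε := div_pos (by linarith) (by linarith)
    have hεS : (S + 1) * ε = a - intForm h (finPart y) := mul_div_cancel₀ _ (by linarith)
    filter_upwards [eventually_near y 0 hε0] with z hz x hx
    obtain ⟨hb, hf⟩ := hz x hx
    have : ∑ i, (h i : ℝ) * (x i - finPart y i) ≤ ∑ i, |(h i : ℝ)| * ε :=
      Finset.sum_le_sum fun i _ => (intForm_sub_le h hf hnn hb i).elim id fun h' =>
        h'.2.trans (mul_nonneg (abs_nonneg _) hε0.le)
    rw [← hsum, ← Finset.sum_mul, ← hS] at this
    linarith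
  -- An integer positive coefficient is at least `1`, so the coordinate `i₀` contributes at most
  -- `-K`, while all the others together contribute at most `S`.
  · set K : ℝ := S + |a - intForm h (finPart y)| + 1 with hK
    have hK0 : 0 < K := by positivity
    filter_upwards [eventually_near y (-K) one_pos] with z hz x hx
    obtain ⟨hb, hf⟩ := hz x hx
    have hb' : ∀ i, y i = ⊥ → x i < 0 := fun i hi => (hb i hi).trans (by linarith)
    have hpos : (1 : ℝ) ≤ h i₀ := by
      exact_mod_cast lt_of_le_of_ne (hnn i₀ hi₀) hne.symm
    have h1 : (h i₀ : ℝ) * (x i₀ - finPart y i₀) ≤ -K := by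
      rw [finPart_of_bot hi₀, sub_zero]
      have := hb i₀ hi₀
      nlinarith
    have : ∑ i ∈ Finset.univ.erase i₀, (h i : ℝ) * (x i - finPart y i) ≤
        ∑ i ∈ Finset.univ.erase i₀, |(h i : ℝ)| :=
      Finset.sum_le_sum fun i _ => (intForm_sub_le h hf hnn hb' i).elim (by simp) fun h' =>
        h'.2.trans (abs_nonneg _)
    have h2 : ∑ i ∈ Finset.univ.erase i₀, |(h i : ℝ)| ≤ S :=
      Finset.sum_le_univ_sum_of_nonneg fun i => abs_nonneg _
    have h3 := hsum x
    rw [← Finset.add_sum_erase _ _ (Finset.mem_univ i₀)] at h3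
    have h4 := neg_abs_le (a - intForm h (finPart y))
    linarith

lemma intForm_congr {h : Fin N → ℤ} {y : TropVec N} (hz : ∀ i, y i = ⊥ → h i = 0) {x x' : Vec N}
    (hx : ∀ i, y i ≠ ⊥ → x i = x' i) : intForm h x = intForm h x' := by
  rw [intForm_apply, intForm_apply]
  refine Finset.sum_congr rfl fun i _ => ?_
  by_cases hi : y i = ⊥
  · simp [hz i hi]
  · rw [hx i hi]

/-- The set `C` is a cone, invariant in the infinite directions at `y`, and `finPart y + C`
coincides with `D` near `y`. -/
structure IsLocalCone (D : Set (Vec N)) (y : TropVec N) (C : Set (Vec N)) : Prop where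
  smul_mem : ∀ u ∈ C, ∀ c : ℝ, 0 < c → c • u ∈ C
  add_mem : ∀ u ∈ C, ∀ r : Vec N, (∀ i, y i ≠ ⊥ → r i = 0) → u + r ∈ C
  eventually : ∀ᶠ z in 𝓝 y, ∀ x, toTrop x = z → (x ∈ D ↔ x - finPart y ∈ C)

/-- The cone is cut out by the inequalities active at `y`: no dependence on infinite coordinates,
and equality at `finPart y`. By `exists_nonneg` every other form tends to `-∞` at `y` or stays
strictly below its bound, so it imposes nothing nearby. -/
lemma IsRegularPoly.exists_isLocalCone {D : Set (Vec N)} (hD : IsRegularPoly D) {y : TropVec N}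
    (hy : y ∈ domain D) : ∃ C, (0 : Vec N) ∈ C ∧ IsLocalCone D y C := by
  classical
  obtain ⟨H, hH, hnn⟩ := hD.exists_nonneg hy
  let A : (Fin N → ℤ) × ℝ → Prop := fun h =>
    (∀ i, y i = ⊥ → h.1 i = 0) ∧ intForm h.1 (finPart y) = h.2
  refine ⟨{u | ∀ h ∈ H, A h → intForm h.1 u ≤ 0}, by simp, ?_, ?_, ?_⟩
  · intro u hu c hc h hh hA
    rw [map_smul, smul_eq_mul]
    exact mul_nonpos_of_nonneg_of_nonpos hc.le (hu h hh hA)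
  · intro u hu r hr h hh hA
    rw [intForm_congr hA.1 (x' := u) fun i hi => by simp [hr i hi]]
    exact hu h hh hA
  · have key : ∀ h ∈ H, ∀ᶠ z in 𝓝 y, ∀ x, toTrop x = z →
        (intForm h.1 x ≤ h.2 ↔ (A h → intForm h.1 (x - finPart y) ≤ 0)) := by
      intro h hh
      by_cases hA : A h
      · refine Eventually.of_forall fun z x _ => ?_
        simp [hA, hA.2]
      · have hlt : intForm h.1 (finPart y) < h.2 ∨ ∃ i, y i = ⊥ ∧ h.1 i ≠ 0 := by
          by_cases hz : ∀ i, y i = ⊥ → h.1 i = 0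
          · left
            have hne : intForm h.1 (finPart y) ≠ h.2 := fun he => hA ⟨hz, he⟩
            refine lt_of_le_of_ne ?_ hne
            by_contra! hgt
            -- otherwise `D` would miss a neighbourhood of `y`
            have hev := eventually_intForm_lt (-h.1) (y := y) (a := -h.2)
              (fun i hi => by simp [hz i hi]) (Or.inl (by
                simp only [intForm_apply] at hgt ⊢
                simpa using hgt))
            obtain ⟨x, hx, hxn⟩ := exists_near hy hev
            have h1 := hxn x rfl
            rw [hH, mem_halfSpaces] at hx
            have h2 := hx h hh
            simp only [intForm_apply] at h1 h2
            simp at h1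
            linarith
          · right
            push Not at hz
            exact hz
        filter_upwards [eventually_intForm_lt h.1 (hnn h hh) hlt] with z hz x hx
        simp [hA, (hz x hx).le]
    filter_upwards [(Finset.eventually_all H).2 key] with z hz x hx
    rw [hH, mem_halfSpaces]
    exact forall₂_congr fun h hh => hz h hh x hx

lemma mobileShift_sub_eq_zero (y : TropVec N) (M : ℝ) (i : Fin N) (hi : y i ≠ ⊥) :
    (PolyComplex.mobileShift y M - finPart y) i = 0 := by
  simp [mobileShift_of_ne_bot hi]

lemma IsRegularPoly.eventually_mobileShift_mem {D : Set (Vec N)} (hD : IsRegularPoly D)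
    {y : TropVec N} (hy : y ∈ domain D) :
    ∀ᶠ M in atTop, PolyComplex.mobileShift y M ∈ D := by
  obtain ⟨C, h0, hC⟩ := hD.exists_isLocalCone hy
  filter_upwards [(tendsto_mobileShift y).eventually hC.eventually] with M hM
  rw [hM _ rfl]
  simpa using hC.add_mem 0 h0 _ (mobileShift_sub_eq_zero y M)

/-- `D` is a face of itself (no wall imposed), and `exists_recession` supplies the direction. -/
lemma IsRegularPoly.ker_killCoords_le {D : Set (Vec N)} (hD : IsRegularPoly D)
    {y : TropVec N} (hy : y ∈ domain D) :
    LinearMap.ker (killCoords (refSed y)) ≤ vectorSpan ℝ D := by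
  obtain ⟨H, hH⟩ := hD.isRatPoly
  obtain ⟨v, hv, hneg, hzero⟩ := exists_recession (hH ▸ hy)
  refine ker_killCoords_le_of_recession hD.nonempty (hD.regular D ⟨hD.nonempty, H, hH, ∅, by simp,
    by simp⟩) ?_ hneg hzero
  intro x hx s hs
  rw [hH, mem_halfSpaces] at hx ⊢
  intro h hh
  have h1 := hx h hh
  have h2 := mul_nonpos_of_nonneg_of_nonpos hs (hv h hh)
  simp only [map_add, map_smul, smul_eq_mul]
  linarith

/-- If `x` lies over `y ∈ D` along the infinite directions, then `x` is in the affine span of `D`. -/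
lemma IsRegularPoly.sub_mem_vectorSpan {D : Set (Vec N)} (hD : IsRegularPoly D)
    {y : TropVec N} (hy : y ∈ domain D) {x d : Vec N} (hx : ∀ i, y i ≠ ⊥ → x i = finPart y i)
    (hd : d ∈ D) : x - d ∈ vectorSpan ℝ D := by
  obtain ⟨M, hM⟩ := (hD.eventually_mobileShift_mem hy).exists
  have h1 : x - PolyComplex.mobileShift y M ∈ vectorSpan ℝ D :=
    hD.ker_killCoords_le hy (mem_ker_killCoords.2 fun i hi => by
      rw [Pi.sub_apply, hx i hi, mobileShift_of_ne_bot hi, sub_self])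
  have h2 : PolyComplex.mobileShift y M - d ∈ vectorSpan ℝ D := vsub_mem_vectorSpan ℝ hM hd
  simpa using add_mem h1 h2

end RegularPoly

/-! ### Relative interior points and integer tangent vectors -/

section RelativeInterior

variable {N : ℕ}

/-- From `x ∈ D` one can move a little in `D` along any vector tangent to `D`. -/
def IsRelInt (D : Set (Vec N)) (x : Vec N) : Prop :=
  x ∈ D ∧ ∀ u ∈ vectorSpan ℝ D, ∀ᶠ ε in 𝓝 (0 : ℝ), x + ε • u ∈ D

/-- A midpoint inherits strictness from either end, so points strict for single inequalities are
averaged into one that is strict for every inequality except the implicit equalities. -/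
lemma exists_strict {H : Finset ((Fin N → ℤ) × ℝ)} (hne : (halfSpaces H).Nonempty)
    (T : Finset ((Fin N → ℤ) × ℝ)) : T ⊆ H →
    ∃ x ∈ halfSpaces H, ∀ h ∈ T,
      intForm h.1 x < h.2 ∨ ∀ x' ∈ halfSpaces H, intForm h.1 x' = h.2 := by
  classical
  induction T using Finset.induction_on with
  | empty => exact fun _ => ⟨hne.some, hne.some_mem, by simp⟩
  | insert k T hk ih =>
    intro hT
    obtain ⟨x, hx, hxT⟩ := ih ((Finset.subset_insert k T).trans hT)
    by_cases hkk : ∀ x' ∈ halfSpaces H, intForm k.1 x' = k.2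
    · refine ⟨x, hx, fun h hh => ?_⟩
      rcases Finset.mem_insert.1 hh with rfl | hh
      · exact Or.inr hkk
      · exact hxT h hh
    push Not at hkk
    obtain ⟨x', hx', hne'⟩ := hkk
    have hlt := lt_of_le_of_ne (mem_halfSpaces.1 hx' k (hT (Finset.mem_insert_self _ _))) hne'
    refine ⟨(1 / 2 : ℝ) • x + (1 / 2 : ℝ) • x',
      convex_halfSpaces H hx hx' (by norm_num) (by norm_num) (by norm_num), fun h hh => ?_⟩
    have h1 := mem_halfSpaces.1 hx h (hT hh)
    have h2 := mem_halfSpaces.1 hx' h (hT hh)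
    simp only [map_add, map_smul, smul_eq_mul]
    rcases Finset.mem_insert.1 hh with rfl | hh
    · left; linarith
    · rcases hxT h hh with h3 | h3
      · left; linarith
      · exact Or.inr h3

lemma intForm_eq_zero_of_mem_vectorSpan {D : Set (Vec N)} {h : Fin N → ℤ} {a : ℝ}
    (ha : ∀ x ∈ D, intForm h x = a) {u : Vec N} (hu : u ∈ vectorSpan ℝ D) : intForm h u = 0 := by
  have : vectorSpan ℝ D ≤ LinearMap.ker (intForm h) := by
    rw [vectorSpan, Submodule.span_le]
    rintro _ ⟨x, hx, x', hx', rfl⟩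
    simp [ha x hx, ha x' hx']
  exact this hu

lemma eventually_add_smul_mem {H : Finset ((Fin N → ℤ) × ℝ)} {x u : Vec N}
    (hx : x ∈ halfSpaces H) (hu : ∀ h ∈ H, intForm h.1 x < h.2 ∨ intForm h.1 u = 0) :
    ∀ᶠ ε in 𝓝 (0 : ℝ), x + ε • u ∈ halfSpaces H := by
  have key : ∀ h ∈ H, ∀ᶠ ε in 𝓝 (0 : ℝ), intForm h.1 (x + ε • u) ≤ h.2 := by
    intro h hh
    simp only [map_add, map_smul, smul_eq_mul]
    rcases hu h hh with h1 | h1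
    · have hc : Tendsto (fun ε : ℝ => intForm h.1 x + ε * intForm h.1 u) (𝓝 0)
          (𝓝 (intForm h.1 x + 0 * intForm h.1 u)) := by
        apply Continuous.tendsto (f := fun ε : ℝ => intForm h.1 x + ε * intForm h.1 u)
        fun_prop
      rw [zero_mul, add_zero] at hc
      exact (hc.eventually_lt_const h1).mono fun _ => le_of_lt
    · refine Eventually.of_forall fun ε => ?_
      rw [h1, mul_zero, add_zero]
      exact mem_halfSpaces.1 hx h hh
  filter_upwards [(Finset.eventually_all H).2 key] with ε hε
  exact mem_halfSpaces.2 hε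

lemma isRelInt_of_strict {H : Finset ((Fin N → ℤ) × ℝ)} {x : Vec N} (hx : x ∈ halfSpaces H)
    (hs : ∀ h ∈ H, intForm h.1 x < h.2 ∨ ∀ x' ∈ halfSpaces H, intForm h.1 x' = h.2) :
    IsRelInt (halfSpaces H) x :=
  ⟨hx, fun _ hu => eventually_add_smul_mem hx fun h hh =>
    (hs h hh).imp id fun h' => intForm_eq_zero_of_mem_vectorSpan h' hu⟩

/-- A nearby point of `D` is moved slightly towards a point where all inequalities other than the
implicit equalities are strict. -/
lemma exists_isRelInt_near {D : Set (Vec N)} (hD : IsRatPoly D) {y : TropVec N}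
    (hy : y ∈ domain D) {P : TropVec N → Prop} (hP : ∀ᶠ z in 𝓝 y, P z) :
    ∃ x, IsRelInt D x ∧ P (toTrop x) := by
  obtain ⟨H, rfl⟩ := hD
  obtain ⟨x, hx, hPx⟩ := exists_near hy (eventually_eventually_nhds.2 hP)
  obtain ⟨x₀, hx₀, hs⟩ := exists_strict ⟨x, hx⟩ H subset_rfl
  have ht : Tendsto (fun ε : ℝ => toTrop ((1 - ε) • x + ε • x₀)) (𝓝[>] 0) (𝓝 (toTrop x)) := by
    have hc : Continuous fun ε : ℝ => toTrop ((1 - ε) • x + ε • x₀) :=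
      continuous_toTrop.comp (by fun_prop)
    have := (hc.tendsto 0).mono_left (nhdsWithin_le_nhds (s := Ioi 0))
    simpa using this
  have h1 : ∀ᶠ ε : ℝ in 𝓝[>] 0, ε < 1 := nhdsWithin_le_nhds (eventually_lt_nhds one_pos)
  obtain ⟨ε, hPε, hε1, hε0⟩ := ((ht.eventually hPx).and (h1.and self_mem_nhdsWithin)).exists
  have hε0' : 0 < ε := hε0
  refine ⟨_, isRelInt_of_strict (convex_halfSpaces H hx hx₀ (by linarith) hε0'.le (by ring)) ?_,
    hPε⟩
  intro h hh
  refine (hs h hh).imp (fun h2 => ?_) id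
  have h3 := mul_le_mul_of_nonneg_left (mem_halfSpaces.1 hx h hh) (by linarith : (0 : ℝ) ≤ 1 - ε)
  have h4 := mul_lt_mul_of_pos_left h2 hε0'
  simp only [map_add, map_smul, smul_eq_mul]
  linarith

/-- For a new form `k` and an integer vector `s` of the old space with `k s ≠ 0`, the map `v ↦ k(s)
v - k(v) s` sends integer vectors to integer vectors in `ker k` and multiplies elements of `ker k`
by `k(s)`. -/
lemma mem_span_isIntegral (T : Finset (Fin N → ℤ)) : ∀ u : Vec N, (∀ h ∈ T, intForm h u = 0) →
    u ∈ Submodule.span ℝ {v : Vec N | IsIntegral v ∧ ∀ h ∈ T, intForm h v = 0} := by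
  classical
  induction T using Finset.induction_on with
  | empty =>
    intro u _
    rw [pi_eq_sum_univ u]
    refine Submodule.sum_mem _ fun i _ => Submodule.smul_mem _ _ (Submodule.subset_span ?_)
    refine ⟨fun j => ?_, by simp⟩
    by_cases h : i = j
    · exact ⟨1, by simp [h]⟩
    · exact ⟨0, by simp [h]⟩
  | insert k T hk ih =>
    intro u hu
    set S := {v : Vec N | IsIntegral v ∧ ∀ h ∈ T, intForm h v = 0} with hS
    have huS := ih u fun h hh => hu h (Finset.mem_insert_of_mem hh)
    by_cases hk0 : ∀ v ∈ S, intForm k v = 0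
    · refine Submodule.span_mono (fun v hv => ?_) huS
      refine ⟨hv.1, fun h hh => ?_⟩
      rcases Finset.mem_insert.1 hh with rfl | hh
      · exact hk0 v hv
      · exact hv.2 h hh
    push Not at hk0
    obtain ⟨s, hs, hs0⟩ := hk0
    have hint : ∀ v : Vec N, IsIntegral v → ∃ m : ℤ, intForm k v = m := by
      intro v hv
      choose m hm using hv
      exact ⟨∑ i, k i * m i, by simp [intForm_apply, hm]⟩
    let p : Vec N →ₗ[ℝ] Vec N := intForm k s • LinearMap.id - (intForm k).smulRight s
    have hp : ∀ v, p v = intForm k s • v - intForm k v • s := fun v => rfl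
    have hpu : p u ∈ Submodule.span ℝ
        {v : Vec N | IsIntegral v ∧ ∀ h ∈ insert k T, intForm h v = 0} := by
      have := Submodule.mem_map_of_mem (f := p) huS
      rw [Submodule.map_span] at this
      refine Submodule.span_mono ?_ this
      rintro _ ⟨v, hv, rfl⟩
      refine ⟨fun i => ?_, fun h hh => ?_⟩
      · obtain ⟨m, hm⟩ := hint v hv.1
        obtain ⟨n, hn⟩ := hint s hs.1
        obtain ⟨a, ha⟩ := hv.1 i
        obtain ⟨b, hb⟩ := hs.1 i
        exact ⟨n * a - m * b, by simp [hp, hm, hn, ha, hb]⟩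
      · rw [hp, map_sub, map_smul, map_smul]
        rcases Finset.mem_insert.1 hh with rfl | hh
        · simp [mul_comm]
        · simp [hv.2 h hh, hs.2 h hh]
    have : u = (intForm k s)⁻¹ • p u := by
      rw [hp, hu k (Finset.mem_insert_self _ _), zero_smul, sub_zero, inv_smul_smul₀ hs0]
    rw [this]
    exact Submodule.smul_mem _ _ hpu

/-- The tangent space of a polyhedron with rational slopes is spanned by integer vectors. -/
lemma IsRatPoly.vectorSpan_le_span {D : Set (Vec N)} (hD : IsRatPoly D) (hne : D.Nonempty) :
    vectorSpan ℝ D ≤ Submodule.span ℝ {v : Vec N | IsIntegral v ∧ v ∈ vectorSpan ℝ D} := by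
  classical
  obtain ⟨H, rfl⟩ := hD
  obtain ⟨x, hx, hs⟩ := exists_strict hne H subset_rfl
  intro u hu
  refine Submodule.span_mono ?_ (mem_span_isIntegral
    ((H.filter fun h => ∀ x' ∈ halfSpaces H, intForm h.1 x' = h.2).image Prod.fst) u ?_)
  · rintro v ⟨hv, hvT⟩
    refine ⟨hv, ?_⟩
    have hev := eventually_add_smul_mem hx (u := v) fun h hh => (hs h hh).imp id fun h' =>
      hvT h.1 (Finset.mem_image_of_mem _ (Finset.mem_filter.2 ⟨hh, h'⟩))
    obtain ⟨ε, hε, hε0⟩ := ((hev.filter_mono (nhdsWithin_le_nhds (s := Ioi 0))).and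
      self_mem_nhdsWithin).exists
    have h1 := vsub_mem_vectorSpan ℝ hε hx
    rw [vsub_eq_sub, add_sub_cancel_left] at h1
    have := Submodule.smul_mem _ ε⁻¹ h1
    rwa [inv_smul_smul₀ (ne_of_gt hε0)] at this
  · intro h hh
    obtain ⟨k, hk, rfl⟩ := Finset.mem_image.1 hh
    exact intForm_eq_zero_of_mem_vectorSpan (Finset.mem_filter.1 hk).2 hu

end RelativeInterior

/-! ### Local structure of a complex and its wave tangent spaces. -/

namespace PolyComplex

variable {N n : ℕ} (Y : PolyComplex N n)

lemma vectorSpan_eq_of_le {D D' : Set (Vec N)} (hD : D ∈ Y.facets) (hD' : D' ∈ Y.facets)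
    (h : vectorSpan ℝ D ≤ vectorSpan ℝ D') : vectorSpan ℝ D = vectorSpan ℝ D' :=
  Submodule.eq_of_le_of_finrank_eq h ((Y.dim_eq D hD).trans (Y.dim_eq D' hD').symm)

/-- `D ∩ D'` is a face of `D` containing a relative interior point, hence all of `D`; then equality
of dimensions applies. -/
lemma vectorSpan_eq_of_isRelInt {D D' : Set (Vec N)} (hD : D ∈ Y.facets) (hD' : D' ∈ Y.facets)
    {x : Vec N} (hx : IsRelInt D x) (hx' : x ∈ D') : vectorSpan ℝ D = vectorSpan ℝ D' := by
  classical
  refine Y.vectorSpan_eq_of_le hD hD' (vectorSpan_mono ℝ fun d hd => ?_)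
  have hface : IsFace (⋂ E ∈ ({D, D'} : Finset (Set (Vec N))), E) D := by
    refine Y.inter_isFace {D, D'} ?_ ⟨x, ?_⟩ D (by simp)
    · intro E hE
      rcases Finset.mem_insert.1 hE with rfl | hE
      · exact hD
      · rwa [Finset.mem_singleton.1 hE]
    · simp [hx.1, hx']
  have hint : (⋂ E ∈ ({D, D'} : Finset (Set (Vec N))), E) = D ∩ D' := by
    ext z; simp
  rw [hint] at hface
  obtain ⟨-, H, hH, K, hK, heq⟩ := hface
  have hxK : ∀ h ∈ K, intForm h.1 x = h.2 := by
    have : x ∈ D ∩ D' := ⟨hx.1, hx'⟩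
    rw [heq] at this
    intro h hh
    rw [intForm_apply]
    exact this.2 h hh
  have : d ∈ D ∩ D' := by
    rw [heq]
    refine ⟨hd, fun h hh => ?_⟩
    rw [← intForm_apply]
    refine le_antisymm (mem_halfSpaces.1 (hH ▸ hd) h (hK hh)) ?_
    -- A small move from `x` away from `d` stays in `D`, so a wall through `x` cannot be strict at
    -- `d`.
    have hev := hx.2 (x - d) (vsub_mem_vectorSpan ℝ hx.1 hd)
    obtain ⟨ε, hε, hε0⟩ := ((hev.filter_mono (nhdsWithin_le_nhds (s := Ioi 0))).and
      self_mem_nhdsWithin).exists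
    have hε0' : 0 < ε := hε0
    rw [hH, mem_halfSpaces] at hε
    have h1 := hε h (hK hh)
    simp only [map_add, map_smul, map_sub, smul_eq_mul, hxK h hh] at h1
    by_contra! hlt
    have := mul_pos hε0' (sub_pos.2 hlt)
    linarith
  exact this.2

/-- Near a relative interior point of a facet, the complex is contained in the affine span of
this facet. -/
lemma eventually_sub_mem_vectorSpan {D : Set (Vec N)} (hD : D ∈ Y.facets) {x : Vec N}
    (hx : IsRelInt D x) : ∀ᶠ x' in 𝓝 x, x' ∈ Y.mobilePart → x' - x ∈ vectorSpan ℝ D := by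
  have key : ∀ D' ∈ Y.facets, ∀ᶠ x' in 𝓝 x, x' ∈ D' → x' - x ∈ vectorSpan ℝ D := by
    intro D' hD'
    by_cases hxD' : x ∈ D'
    · refine Eventually.of_forall fun x' hx' => ?_
      rw [Y.vectorSpan_eq_of_isRelInt hD hD' hx hxD']
      exact vsub_mem_vectorSpan ℝ hx' hxD'
    · have hcl : IsClosed D' := by
        obtain ⟨H, hH⟩ := Y.isRatPoly D' hD'
        exact hH ▸ isClosed_halfSpaces H
      filter_upwards [hcl.isOpen_compl.mem_nhds hxD'] with x' h h'
      exact absurd h' h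
  filter_upwards [(Finset.eventually_all Y.facets).2 key] with x' h hx'
  obtain ⟨D', hD', hx'⟩ := mem_iUnion₂.1 hx'
  exact h D' hD' hx'

lemma mem_mobilePart {D : Set (Vec N)} (hD : D ∈ Y.facets) {x : Vec N} (hx : x ∈ D) :
    x ∈ Y.mobilePart := mem_iUnion₂.2 ⟨D, hD, hx⟩

/-- A facet meeting every neighbourhood of `y` contains `y`. -/
lemma eventually_mem_domain (y : TropVec N) :
    ∀ᶠ z in 𝓝 y, ∀ D ∈ Y.facets, z ∈ domain D → y ∈ domain D := by
  refine (Finset.eventually_all Y.facets).2 fun D _ => ?_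
  by_cases hy : y ∈ domain D
  · exact Eventually.of_forall fun _ _ => hy
  · filter_upwards [isClosed_closure.isOpen_compl.mem_nhds hy] with z h h'
    exact absurd h' h

/-- The union of the cones of the facets through `y`; the other facets are closed and avoid a
neighbourhood of `y`. -/
lemma exists_isLocalCone (y : TropVec N) : ∃ C, IsLocalCone Y.mobilePart y C := by
  have hex : ∀ D, ∃ C : Set (Vec N), D ∈ Y.facets → y ∈ domain D → IsLocalCone D y C := by
    intro D
    by_cases hD : D ∈ Y.facets ∧ y ∈ domain D
    · obtain ⟨C, -, hC⟩ := (Y.isRegularPoly hD.1).exists_isLocalCone hD.2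
      exact ⟨C, fun _ _ => hC⟩
    · exact ⟨∅, fun h1 h2 => absurd ⟨h1, h2⟩ hD⟩
  choose C hC using hex
  refine ⟨{u | ∃ D ∈ Y.facets, y ∈ domain D ∧ u ∈ C D}, ?_, ?_, ?_⟩
  · rintro u ⟨D, hD, hy, hu⟩ c hc
    exact ⟨D, hD, hy, (hC D hD hy).smul_mem u hu c hc⟩
  · rintro u ⟨D, hD, hy, hu⟩ r hr
    exact ⟨D, hD, hy, (hC D hD hy).add_mem u hu r hr⟩
  · have key : ∀ D ∈ Y.facets, ∀ᶠ z in 𝓝 y, ∀ x, toTrop x = z → y ∈ domain D →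
        (x ∈ D ↔ x - finPart y ∈ C D) := by
      intro D hD
      by_cases hy : y ∈ domain D
      · filter_upwards [(hC D hD hy).eventually] with z hz x hx _ using hz x hx
      · exact Eventually.of_forall fun _ _ _ h => absurd h hy
    filter_upwards [(Finset.eventually_all Y.facets).2 key, Y.eventually_mem_domain y]
      with z hz hz' x hx
    constructor
    · intro h
      obtain ⟨D, hD, hxD⟩ := mem_iUnion₂.1 h
      have hy : y ∈ domain D := hz' D hD (hx ▸ subset_closure (mem_image_of_mem _ hxD))
      exact ⟨D, hD, hy, (hz D hD x hx hy).1 hxD⟩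
    · rintro ⟨D, hD, hy, hu⟩
      exact Y.mem_mobilePart hD ((hz D hD x hx hy).2 hu)

variable {Y}

lemma mem_lineality {C : Set (Vec N)} {u : Vec N} :
    u ∈ lineality C ↔ ∀ v ∈ C, ∀ t : ℝ, v + t • u ∈ C := Iff.rfl

lemma mem_waveSpace {y : TropVec N} {u : Vec N} :
    u ∈ Y.waveSpace y ↔ ∀ᶠ M in atTop, u ∈ lineality (Y.tangentCone (mobileShift y M)) := Iff.rfl

lemma tendsto_toTrop_add_smul (x u : Vec N) :
    Tendsto (fun ε : ℝ => toTrop (x + ε • u)) (𝓝[>] 0) (𝓝 (toTrop x)) := by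
  have hc : Continuous fun ε : ℝ => toTrop (x + ε • u) := continuous_toTrop.comp (by fun_prop)
  simpa using (hc.tendsto 0).mono_left (nhdsWithin_le_nhds (s := Ioi 0))

lemma eventually_tangentCone_eq {y : TropVec N} {C : Set (Vec N)}
    (hC : IsLocalCone Y.mobilePart y C) : ∀ᶠ z in 𝓝 y, ∀ᶠ M in atTop,
      Y.tangentCone (mobileShift z M) =
        {u | ∀ᶠ ε in 𝓝[>] (0 : ℝ), mobileShift z M - finPart y + ε • u ∈ C} := by
  filter_upwards [eventually_eventually_nhds.2 hC.eventually] with z hz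
  filter_upwards [(tendsto_mobileShift z).eventually (eventually_eventually_nhds.2 hz)] with M hM
  ext u
  change (∀ᶠ ε in 𝓝[>] (0 : ℝ), mobileShift z M + ε • u ∈ Y.mobilePart) ↔
    ∀ᶠ ε in 𝓝[>] (0 : ℝ), mobileShift z M - finPart y + ε • u ∈ C
  refine eventually_congr ?_
  filter_upwards [(tendsto_toTrop_add_smul _ u).eventually hM] with ε hε
  rw [hε _ rfl, sub_add_eq_add_sub]

lemma _root_.TropGeom.IsLocalCone.add_mem_iff {D : Set (Vec N)} {y : TropVec N} {C : Set (Vec N)}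
    (hC : IsLocalCone D y C) {u r : Vec N} (hr : ∀ i, y i ≠ ⊥ → r i = 0) :
    u + r ∈ C ↔ u ∈ C := by
  refine ⟨fun h => ?_, fun h => hC.add_mem u h r hr⟩
  simpa using hC.add_mem _ h (-r) fun i hi => by simp [hr i hi]

lemma _root_.TropGeom.IsLocalCone.smul_mem_iff {D : Set (Vec N)} {y : TropVec N} {C : Set (Vec N)}
    (hC : IsLocalCone D y C) {u : Vec N} {c : ℝ} (hc : 0 < c) : c • u ∈ C ↔ u ∈ C := by
  refine ⟨fun h => ?_, fun h => hC.smul_mem u h c hc⟩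
  simpa [inv_smul_smul₀ hc.ne'] using hC.smul_mem _ h c⁻¹ (inv_pos.2 hc)

/-- A mobile shift of `y` differs from `finPart y` only in infinite directions. Since `C` is
invariant in these and under scaling, the tangent cone at the shift is `C` itself. -/
lemma waveSpace_eq_lineality {y : TropVec N} {C : Set (Vec N)}
    (hC : IsLocalCone Y.mobilePart y C) : Y.waveSpace y = lineality C := by
  have hev : ∀ᶠ M in atTop, Y.tangentCone (mobileShift y M) = C := by
    filter_upwards [(eventually_tangentCone_eq hC).self_of_nhds] with M hM
    rw [hM]
    ext u
    have h1 : ∀ᶠ ε in 𝓝[>] (0 : ℝ),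
        (mobileShift y M - finPart y + ε • u ∈ C ↔ u ∈ C) := by
      filter_upwards [self_mem_nhdsWithin] with ε hε
      rw [add_comm, hC.add_mem_iff (mobileShift_sub_eq_zero y M), hC.smul_mem_iff hε]
    exact (eventually_congr h1).trans eventually_const
  ext u
  rw [mem_waveSpace]
  refine (eventually_congr (q := fun _ => u ∈ lineality C) ?_).trans eventually_const
  filter_upwards [hev] with M hM
  rw [hM]

/-- The wave tangent spaces are semicontinuous. -/
lemma eventually_waveSpace_le (y : TropVec N) :
    ∀ᶠ z in 𝓝 y, Y.waveSpace y ≤ Y.waveSpace z := by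
  obtain ⟨C, hC⟩ := Y.exists_isLocalCone y
  filter_upwards [eventually_tangentCone_eq hC] with z hz u hu
  rw [waveSpace_eq_lineality hC] at hu
  rw [mem_waveSpace]
  filter_upwards [hz] with M hM
  rw [hM]
  intro v hv t
  change ∀ᶠ ε in 𝓝[>] (0 : ℝ), mobileShift z M - finPart y + ε • v ∈ C at hv
  change ∀ᶠ ε in 𝓝[>] (0 : ℝ), mobileShift z M - finPart y + ε • (v + t • u) ∈ C
  filter_upwards [hv] with ε hε
  have := hu _ hε (ε * t)
  rwa [add_assoc, ← smul_smul, ← smul_add] at this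

/-- The cone sees the tangent space of `D` near a suitable vector `u₀`, obtained from a relative
interior point of `D` near `y`. -/
lemma exists_nhds_isLocalCone {y : TropVec N} {C : Set (Vec N)}
    (hC : IsLocalCone Y.mobilePart y C) {D : Set (Vec N)} (hD : D ∈ Y.facets)
    (hy : y ∈ domain D) :
    ∃ u₀ ∈ C, ∀ᶠ u in 𝓝 u₀, u ∈ C → u - u₀ ∈ vectorSpan ℝ D := by
  obtain ⟨x, hx, hn⟩ := exists_isRelInt_near (Y.isRatPoly D hD) hy
    (eventually_eventually_nhds.2 hC.eventually)
  refine ⟨x - finPart y, (hn.self_of_nhds x rfl).1 (Y.mem_mobilePart hD hx.1), ?_⟩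
  have h1 := (continuous_toTrop.tendsto x).eventually hn
  have h2 := Y.eventually_sub_mem_vectorSpan hD hx
  have h3 : Tendsto (fun u : Vec N => u + finPart y) (𝓝 (x - finPart y)) (𝓝 x) := by
    have hc : Continuous fun u : Vec N => u + finPart y := by fun_prop
    simpa using hc.tendsto (x - finPart y)
  filter_upwards [h3.eventually (h1.and h2)] with u hu huC
  have h4 := hu.2 ((hu.1 _ rfl).2 (by simpa using huC))
  rwa [show u - (x - finPart y) = u + finPart y - x by abel]

/-- The wave tangent space is contained in the tangent space of every adjacent facet. -/
lemma waveSpace_le_vectorSpan {y : TropVec N} {D : Set (Vec N)} (hD : D ∈ Y.facets)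
    (hy : y ∈ domain D) : Y.waveSpace y ≤ vectorSpan ℝ D := by
  obtain ⟨C, hC⟩ := Y.exists_isLocalCone y
  obtain ⟨u₀, hu₀, hn⟩ := exists_nhds_isLocalCone hC hD hy
  intro u hu
  rw [waveSpace_eq_lineality hC] at hu
  have ht : Tendsto (fun ε : ℝ => u₀ + ε • u) (𝓝[>] 0) (𝓝 u₀) := by
    have hc : Continuous fun ε : ℝ => u₀ + ε • u := by fun_prop
    simpa using (hc.tendsto 0).mono_left (nhdsWithin_le_nhds (s := Ioi 0))
  obtain ⟨ε, hε, hε0⟩ := ((ht.eventually hn).and self_mem_nhdsWithin).exists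
  have h1 := hε (hu u₀ hu₀ ε)
  rw [add_sub_cancel_left] at h1
  have := Submodule.smul_mem _ ε⁻¹ h1
  rwa [inv_smul_smul₀ (ne_of_gt hε0)] at this

end PolyComplex

/-! ### Constancy of the adjacent tangent spaces along strata. -/

namespace PolyComplex

variable {N n : ℕ} {Y : PolyComplex N n}

lemma mem_support {y : TropVec N} : y ∈ Y.support ↔ ∃ D ∈ Y.facets, y ∈ domain D := by
  simp [support]

/-- At a position `w` of a cone the radial direction `w` is always a lineality direction of the
tangent cone: `w + ε (v + t w)` is `1 + ε t` times `w + (ε / (1 + ε t)) v`. So `w` lies in the wave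
space at `z`, which is that at `y`, that is, the lineality space of `C`. -/
lemma mem_lineality_of_mem_waveSpace {y z : TropVec N} {C : Set (Vec N)}
    (hC : IsLocalCone Y.mobilePart y C) (hsed : refSed z = refSed y)
    (hW : Y.waveSpace y = Y.waveSpace z)
    (htc : ∀ᶠ M in atTop, Y.tangentCone (mobileShift z M) =
        {u | ∀ᶠ ε in 𝓝[>] (0 : ℝ), mobileShift z M - finPart y + ε • u ∈ C}) :
    finPart z - finPart y ∈ lineality C := by
  set w := finPart z - finPart y with hw
  have hoff : ∀ M i, y i ≠ ⊥ → (mobileShift z M - finPart z) i = 0 := fun M i hi =>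
    mobileShift_sub_eq_zero z M i fun h => hi (hsed ▸ h : i ∈ refSed y)
  have hiff : ∀ M u, mobileShift z M - finPart y + u ∈ C ↔ w + u ∈ C := by
    intro M u
    rw [show mobileShift z M - finPart y + u = w + u + (mobileShift z M - finPart z) by
      rw [hw]; abel]
    exact hC.add_mem_iff (hoff M)
  rw [← waveSpace_eq_lineality hC, hW, mem_waveSpace]
  filter_upwards [htc] with M hM
  rw [hM]
  intro v hv t
  change ∀ᶠ ε in 𝓝[>] (0 : ℝ), mobileShift z M - finPart y + ε • v ∈ C at hv
  change ∀ᶠ ε in 𝓝[>] (0 : ℝ), mobileShift z M - finPart y + ε • (v + t • w) ∈ C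
  simp only [hiff] at hv ⊢
  have hpos : ∀ᶠ ε in 𝓝[>] (0 : ℝ), 0 < 1 + ε * t := by
    have hc : Continuous fun ε : ℝ => 1 + ε * t := by fun_prop
    have := (hc.tendsto 0).mono_left (nhdsWithin_le_nhds (s := Ioi 0))
    simp only [zero_mul, add_zero] at this
    exact this.eventually (eventually_gt_nhds one_pos)
  have hlim : Tendsto (fun ε : ℝ => ε / (1 + ε * t)) (𝓝[>] 0) (𝓝[>] 0) := by
    refine tendsto_nhdsWithin_iff.2 ⟨?_, ?_⟩
    · have hc : ContinuousAt (fun ε : ℝ => ε / (1 + ε * t)) 0 :=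
        ContinuousAt.div (by fun_prop) (by fun_prop) (by simp)
      have := hc.tendsto.mono_left (nhdsWithin_le_nhds (s := Ioi 0))
      simpa using this
    · filter_upwards [hpos, self_mem_nhdsWithin] with ε h1 h2 using div_pos h2 h1
  filter_upwards [hlim.eventually hv, hpos] with ε h1 h2
  have := hC.smul_mem _ h1 _ h2
  rw [smul_add, smul_smul, mul_div_cancel₀ _ h2.ne'] at this
  rw [show w + ε • (v + t • w) = (1 + ε * t) • w + ε • v by module]
  exact this

/-- If the wave tangent space has the same dimension at a nearby point with the same infinite
coordinates, then this point is adjacent to facets with the same tangent spaces. -/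
lemma eventually_exists_facet (y : TropVec N) :
    ∀ᶠ z in 𝓝 y, z ∈ Y.support → refSed z = refSed y →
      Module.finrank ℝ (Y.waveSpace z) = Module.finrank ℝ (Y.waveSpace y) →
      ∀ D ∈ Y.facets, y ∈ domain D →
        ∃ D' ∈ Y.facets, z ∈ domain D' ∧ vectorSpan ℝ D' = vectorSpan ℝ D := by
  obtain ⟨C, hC⟩ := Y.exists_isLocalCone y
  filter_upwards [eventually_tangentCone_eq hC, eventually_waveSpace_le y,
    eventually_eventually_nhds.2 hC.eventually] with z htc hW hz hzs hsed hfin D hD hy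
  have hlin := mem_lineality_of_mem_waveSpace hC hsed
    (Submodule.eq_of_le_of_finrank_eq hW hfin.symm) htc
  set w := finPart z - finPart y with hw
  have hoff : ∀ M i, y i ≠ ⊥ → (mobileShift z M - finPart z) i = 0 := fun M i hi =>
    mobileShift_sub_eq_zero z M i fun h => hi (hsed ▸ h : i ∈ refSed y)
  -- `C` near `w` is the same as `C` near `0`
  have hiff : ∀ M u, mobileShift z M + u - finPart y ∈ C ↔ u ∈ C := by
    intro M u
    rw [show mobileShift z M + u - finPart y = u + w + (mobileShift z M - finPart z) by
      rw [hw]; abel, hC.add_mem_iff (hoff M)]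
    constructor
    · intro h
      simpa using mem_lineality.1 hlin _ h (-1)
    · intro h
      simpa using mem_lineality.1 hlin _ h 1
  obtain ⟨u₀, hu₀, hn⟩ := exists_nhds_isLocalCone hC hD hy
  -- One parameter drives the infinite coordinates to `-∞` and the displacement to `0`; scaling the
  -- cone by `M` recovers `u₀`.
  have hlim0 : Tendsto (fun M : ℝ => M⁻¹ • u₀) atTop (𝓝 0) := by
    simpa using (tendsto_inv_atTop_zero (𝕜 := ℝ)).smul_const u₀
  have hlim := tendsto_mobileShift_add z hlim0
  have hex : ∀ᶠ M in atTop, ∃ D' ∈ Y.facets, mobileShift z M + M⁻¹ • u₀ ∈ D' ∧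
      vectorSpan ℝ D' = vectorSpan ℝ D := by
    filter_upwards [hlim.eventually (eventually_eventually_nhds.2 hz), eventually_gt_atTop 0]
      with M hM hM0
    set x := mobileShift z M + M⁻¹ • u₀ with hx
    have hxY : x ∈ Y.mobilePart := (hM.self_of_nhds x rfl).2
      ((hiff M _).2 (hC.smul_mem u₀ hu₀ _ (inv_pos.2 hM0)))
    obtain ⟨D', hD', hxD'⟩ := mem_iUnion₂.1 hxY
    refine ⟨D', hD', hxD', Y.vectorSpan_eq_of_le hD' hD ?_⟩
    rw [vectorSpan_eq_span_vsub_set_right ℝ hxD', Submodule.span_le]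
    rintro _ ⟨x', hx', rfl⟩
    change x' - x ∈ vectorSpan ℝ D
    -- Vectors tangent to `D'` at `x` become, after scaling, small moves from `u₀` inside `C`, and
    -- these are tangent to `D`.
    have h1 : ∀ᶠ ε in 𝓝[>] (0 : ℝ), u₀ + (M * ε) • (x' - x) ∈ C := by
      have hle : ∀ᶠ ε : ℝ in 𝓝[>] 0, ε < 1 := nhdsWithin_le_nhds (eventually_lt_nhds one_pos)
      filter_upwards [(tendsto_toTrop_add_smul x (x' - x)).eventually hM, hle,
        self_mem_nhdsWithin] with ε hε hε1 hε0
      have hε0' : 0 < ε := hε0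
      have hmem : x + ε • (x' - x) ∈ D' := by
        obtain ⟨H, hH⟩ := Y.isRatPoly D' hD'
        have := (hH ▸ convex_halfSpaces H : Convex ℝ D') hxD' hx'
          (by linarith : 0 ≤ 1 - ε) hε0'.le (by ring)
        rwa [show x + ε • (x' - x) = (1 - ε) • x + ε • x' by module]
      have h2 := (hε _ rfl).1 (Y.mem_mobilePart hD' hmem)
      rw [hx, add_assoc, hiff, ← hx] at h2
      have h3 := hC.smul_mem _ h2 M hM0
      rwa [smul_add, smul_inv_smul₀ hM0.ne', smul_smul] at h3
    have ht : Tendsto (fun ε : ℝ => u₀ + (M * ε) • (x' - x)) (𝓝[>] 0) (𝓝 u₀) := by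
      have hc : Continuous fun ε : ℝ => u₀ + (M * ε) • (x' - x) := by fun_prop
      simpa using (hc.tendsto 0).mono_left (nhdsWithin_le_nhds (s := Ioi 0))
    obtain ⟨ε, ⟨hε, hεC⟩, hε0⟩ := (((ht.eventually hn).and h1).and self_mem_nhdsWithin).exists
    have h4 := hε hεC
    rw [add_sub_cancel_left] at h4
    have := Submodule.smul_mem _ (M * ε)⁻¹ h4
    rwa [inv_smul_smul₀ (mul_pos hM0 hε0).ne'] at this
  by_contra! hcon
  have hnot : ∀ᶠ z' in 𝓝 z, ∀ D' ∈ Y.facets, vectorSpan ℝ D' = vectorSpan ℝ D →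
      z' ∉ domain D' := by
    refine (Finset.eventually_all Y.facets).2 fun D' hD' => ?_
    by_cases hzD' : z ∈ domain D'
    · exact Eventually.of_forall fun _ h => absurd h (hcon D' hD' hzD')
    · filter_upwards [isClosed_closure.isOpen_compl.mem_nhds hzD'] with z' hz' _ using hz'
  obtain ⟨M, ⟨D', hD', hx, hL⟩, hM⟩ := (hex.and (hlim.eventually hnot)).exists
  exact hM D' hD' hL (subset_closure (mem_image_of_mem _ hx))

/-- The tangent spaces of the facets adjacent to a point. -/
def tangentSpaces (Y : PolyComplex N n) (y : TropVec N) : Set (Submodule ℝ (Vec N)) :=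
  {L | ∃ D ∈ Y.facets, y ∈ domain D ∧ vectorSpan ℝ D = L}

lemma eventually_tangentSpaces_subset (y : TropVec N) :
    ∀ᶠ z in 𝓝 y, Y.tangentSpaces z ⊆ Y.tangentSpaces y := by
  filter_upwards [Y.eventually_mem_domain y] with z hz L
  rintro ⟨D, hD, hzD, rfl⟩
  exact ⟨D, hD, hz D hD hzD, rfl⟩

/-- The sedentarity is only a cardinality, but nearby the refined sedentarity can only shrink, so
equal cardinality forces equality. -/
lemma eventually_tangentSpaces_eq (y : TropVec N) :
    ∀ᶠ z in 𝓝 y, z ∈ Y.support → sed z = sed y →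
      Module.finrank ℝ (Y.waveSpace z) = Module.finrank ℝ (Y.waveSpace y) →
      refSed z = refSed y ∧ Y.tangentSpaces z = Y.tangentSpaces y := by
  filter_upwards [eventually_tangentSpaces_subset (Y := Y) y, eventually_refSed_subset y,
    eventually_exists_facet (Y := Y) y] with z h1 h2 h3 hz hsed hfin
  have h4 : refSed z = refSed y := Set.eq_of_subset_of_ncard_le h2 hsed.ge (Set.toFinite _)
  refine ⟨h4, Subset.antisymm h1 ?_⟩
  rintro L ⟨D, hD, hy, rfl⟩
  obtain ⟨D', hD', hzD', hL⟩ := h3 hz h4 hfin D hD hy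
  exact ⟨D', hD', hzD', hL⟩

lemma waveSpace_le_of_mem_tangentSpaces {y : TropVec N} {L : Submodule ℝ (Vec N)}
    (hL : L ∈ Y.tangentSpaces y) : Y.waveSpace y ≤ L := by
  obtain ⟨D, hD, hy, rfl⟩ := hL
  exact waveSpace_le_vectorSpan hD hy

/-! ### Coefficient groups -/

lemma isIntegral_killCoords {I : Set (Fin N)} {v : Vec N} (hv : IsIntegral v) :
    IsIntegral (killCoords I v) := by
  intro i
  by_cases hi : i ∈ I
  · exact ⟨0, by simp [killCoords_of_mem hi]⟩
  · rw [killCoords_of_notMem hi]; exact hv i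

/-- Facets enter `F_k` only through their tangent spaces, so besides the refined sedentarity only
`tangentSpaces` has to be controlled. -/
lemma ιMulti_mem_coeffZ {k : ℕ} {y : TropVec N} {L : Submodule ℝ (Vec N)}
    (hL : L ∈ Y.tangentSpaces y) {v : Fin k → Vec N}
    (hv : ∀ j, IsIntegral (v j) ∧ v j ∈ L.map (killCoords (refSed y))) :
    ExteriorAlgebra.ιMulti ℝ k v ∈ Y.coeffZ k y := by
  obtain ⟨D, hD, hy, rfl⟩ := hL
  exact AddSubgroup.subset_closure ⟨D, hD, hy, v, hv, rfl⟩

lemma coeffZ_induction {k : ℕ} {y : TropVec N} {P : ExteriorAlgebra ℝ (Vec N) → Prop}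
    (hmulti : ∀ L ∈ Y.tangentSpaces y, ∀ v : Fin k → Vec N,
      (∀ j, IsIntegral (v j) ∧ v j ∈ L.map (killCoords (refSed y))) →
        P (ExteriorAlgebra.ιMulti ℝ k v))
    (zero : P 0) (add : ∀ a b, P a → P b → P (a + b)) (neg : ∀ a, P a → P (-a))
    {ω : ExteriorAlgebra ℝ (Vec N)} (hω : ω ∈ Y.coeffZ k y) : P ω := by
  induction hω using AddSubgroup.closure_induction with
  | mem x hx =>
    obtain ⟨D, hD, hy, v, hv, rfl⟩ := hx
    exact hmulti _ ⟨D, hD, hy, rfl⟩ v hv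
  | zero => exact zero
  | add a b _ _ ha hb => exact add a b ha hb
  | neg a _ ha => exact neg a ha

/-- The product of a vector tangent to all the adjacent facets and an element of `F_k(y)` is in
`F_{k+1}(y) ⊗ ℝ`. -/
lemma ι_mul_mem_coeffR {k : ℕ} {y : TropVec N} {u : Vec N}
    (hu : ∀ L ∈ Y.tangentSpaces y, u ∈ L) {ω : ExteriorAlgebra ℝ (Vec N)}
    (hω : ω ∈ Y.coeffZ k y) :
    ExteriorAlgebra.ι ℝ (killCoords (refSed y) u) * ω ∈ Y.coeffR (k + 1) y := by
  refine coeffZ_induction (P := fun ω => ExteriorAlgebra.ι ℝ (killCoords (refSed y) u) * ω ∈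
    Y.coeffR (k + 1) y) ?_ ?_ ?_ ?_ hω
  · intro L hL v hv
    -- `u` is merely a real vector; its expansion in integer vectors of `L` puts the product in the
    -- real span of `F_{k+1}`.
    have huL : u ∈ Submodule.span ℝ {v : Vec N | IsIntegral v ∧ v ∈ L} := by
      obtain ⟨D, hD, hy, rfl⟩ := id hL
      exact (Y.isRatPoly D hD).vectorSpan_le_span (Y.nonempty D hD) (hu _ hL)
    clear hu
    change _ ∈ Submodule.span ℝ (Y.coeffZ (k + 1) y : Set (ExteriorAlgebra ℝ (Vec N)))
    induction huL using Submodule.span_induction with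
    | mem x hx =>
      refine Submodule.subset_span ?_
      have := ιMulti_mem_coeffZ (k := k + 1) hL
        (v := Matrix.vecCons (killCoords (refSed y) x) v) (fun j => by
          refine Fin.cases ?_ (fun j => ?_) j
          · exact ⟨isIntegral_killCoords hx.1, Submodule.mem_map_of_mem hx.2⟩
          · exact hv j)
      rw [ExteriorAlgebra.ιMulti_succ_apply] at this
      simpa using this
    | zero => simp
    | add a b _ _ ha hb =>
      rw [map_add, map_add, add_mul]
      exact Submodule.add_mem _ ha hb
    | smul c a _ ha =>
      rw [map_smul, map_smul, smul_mul_assoc]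
      exact Submodule.smul_mem _ c ha
  · simp [zero_mem]
  · intro a b ha hb
    rw [mul_add]
    exact add_mem ha hb
  · intro a ha
    rw [mul_neg]
    exact neg_mem ha

lemma map_mem_coeffZ {k : ℕ} {y z : TropVec N} (hsed : refSed y ⊆ refSed z)
    (hL : Y.tangentSpaces y ⊆ Y.tangentSpaces z) {ω : ExteriorAlgebra ℝ (Vec N)}
    (hω : ω ∈ Y.coeffZ k y) :
    ExteriorAlgebra.map (killCoords (refSed z)) ω ∈ Y.coeffZ k z := by
  refine coeffZ_induction (P := fun ω => ExteriorAlgebra.map (killCoords (refSed z)) ω ∈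
    Y.coeffZ k z) ?_ (by simp [zero_mem]) ?_ ?_ hω
  · intro L h v hv
    rw [ExteriorAlgebra.map_apply_ιMulti]
    refine ιMulti_mem_coeffZ (hL h) fun j => ⟨isIntegral_killCoords (hv j).1, ?_⟩
    obtain ⟨x, hx, hxv⟩ := (hv j).2
    refine ⟨x, hx, ?_⟩
    rw [Function.comp_apply, ← hxv, killCoords_killCoords hsed]
  · intro a b ha hb
    rw [map_add]
    exact add_mem ha hb
  · intro a ha
    rw [map_neg]
    exact neg_mem ha

lemma map_mem_coeffR {k : ℕ} {y z : TropVec N} (hsed : refSed y ⊆ refSed z)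
    (hL : Y.tangentSpaces y ⊆ Y.tangentSpaces z) {ω : ExteriorAlgebra ℝ (Vec N)}
    (hω : ω ∈ Y.coeffR k y) :
    ExteriorAlgebra.map (killCoords (refSed z)) ω ∈ Y.coeffR k z := by
  have h1 : ω ∈ Submodule.span ℝ (Y.coeffZ k y : Set (ExteriorAlgebra ℝ (Vec N))) := hω
  have h2 := Submodule.mem_map_of_mem
    (f := (ExteriorAlgebra.map (killCoords (refSed z))).toLinearMap) h1
  rw [Submodule.map_span] at h2
  refine Submodule.span_mono ?_ h2
  rintro _ ⟨x, hx, rfl⟩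
  exact map_mem_coeffZ hsed hL hx

end PolyComplex

/-! ### The standard simplex -/

section Simplex

variable {q : ℕ}

lemma barycenter_mem_openFace :
    (stdSimplex.barycenter : stdSimplex ℝ (Fin (q + 1))) ∈ openFace univ := by
  intro i
  have : (0 : ℝ) < (Fintype.card (Fin (q + 1)) : ℝ)⁻¹ := by
    rw [Fintype.card_fin]; positivity
  exact iff_of_true this (mem_univ i)

lemma isPreconnected_openFace_univ :
    IsPreconnected (openFace univ : Set (stdSimplex ℝ (Fin (q + 1)))) := by
  rw [← IsInducing.subtypeVal.isPreconnected_image]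
  refine Convex.isPreconnected ?_
  rintro _ ⟨x, hx, rfl⟩ _ ⟨y, hy, rfl⟩ a b ha hb hab
  refine ⟨⟨a • x.1 + b • y.1, convex_stdSimplex ℝ _ x.2 y.2 ha hb hab⟩, fun i => ?_, rfl⟩
  have h1 : 0 < x.1 i := (hx i).2 (mem_univ i)
  have h2 : 0 < y.1 i := (hy i).2 (mem_univ i)
  simp only [mem_univ, iff_true]
  change 0 < a * x.1 i + b * y.1 i
  rcases ha.lt_or_eq with h | h
  · exact add_pos_of_pos_of_nonneg (mul_pos h h1) (mul_nonneg hb h2.le)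
  · have : b = 1 := by linarith
    simpa [← h, this] using h2

lemma isPreconnected_stdSimplex : IsPreconnected (univ : Set (stdSimplex ℝ (Fin (q + 1)))) := by
  rw [← IsInducing.subtypeVal.isPreconnected_image]
  simpa using (convex_stdSimplex ℝ (Fin (q + 1))).isPreconnected

/-- A point is approached along the segment from the barycenter. -/
lemma exists_openFace_near (t : stdSimplex ℝ (Fin (q + 1))) {P : stdSimplex ℝ (Fin (q + 1)) → Prop}
    (hP : ∀ᶠ t' in 𝓝 t, P t') : ∃ t' ∈ openFace univ, P t' := by
  let b : stdSimplex ℝ (Fin (q + 1)) := stdSimplex.barycenter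
  let γ : Icc (0 : ℝ) 1 → stdSimplex ℝ (Fin (q + 1)) := fun ε =>
    ⟨(1 - ε.1) • t.1 + ε.1 • b.1, convex_stdSimplex ℝ _ t.2 b.2 (by linarith [ε.2.2]) ε.2.1
      (by ring)⟩
  have hγ : Continuous γ := Continuous.subtype_mk (by fun_prop) _
  have hγ0 : γ ⟨0, by simp⟩ = t := Subtype.ext (by simp [γ])
  have hseq : Tendsto (fun n : ℕ => γ ⟨1 / ((n : ℝ) + 1), by positivity, by
      rw [div_le_one (by positivity)]; linarith [Nat.cast_nonneg (α := ℝ) n]⟩) atTop (𝓝 t) := by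
    rw [← hγ0]
    refine (hγ.tendsto _).comp ?_
    rw [tendsto_subtype_rng]
    exact tendsto_one_div_add_atTop_nhds_zero_nat
  obtain ⟨n, hn⟩ := (hseq.eventually hP).exists
  refine ⟨_, fun i => ?_, hn⟩
  simp only [mem_univ, iff_true]
  have h1 : 0 < b.1 i := (barycenter_mem_openFace i).2 (mem_univ i)
  have h2 : 0 ≤ t.1 i := t.2.1 i
  have h3 : (0 : ℝ) < 1 / ((n : ℝ) + 1) := by positivity
  have h4 : 1 / ((n : ℝ) + 1) ≤ 1 := by
    rw [div_le_one (by positivity)]; linarith [Nat.cast_nonneg (α := ℝ) n]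
  change 0 < (1 - 1 / ((n : ℝ) + 1)) * t.1 i + 1 / ((n : ℝ) + 1) * b.1 i
  exact add_pos_of_nonneg_of_pos (mul_nonneg (by linarith) h2) (mul_pos h3 h1)

end Simplex

/-! ### Integral affine maps -/

section Affine

variable {N M : ℕ}

lemma affEval_toTrop (A : Matrix (Fin M) (Fin N) ℤ) (b : Vec M) (x : Vec N) :
    affEval A b (toTrop x) = toTrop (linPart A x + b) := by
  funext j
  have h : ∀ i, intMul (A j i) (toTrop x i) = (((A j i : ℝ) * x i : ℝ) : WithBot ℝ) := by
    intro i
    by_cases h0 : A j i = 0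
    · simp [intMul, h0]
    · simp [intMul, h0, toTrop]
  calc affEval A b (toTrop x) j
      = ∑ i, (((A j i : ℝ) * x i : ℝ) : WithBot ℝ) + (b j : WithBot ℝ) := by
        rw [affEval, Finset.sum_congr rfl fun i _ => h i]
    _ = (((∑ i, (A j i : ℝ) * x i) + b j : ℝ) : WithBot ℝ) := by
        rw [WithBot.coe_add, WithBot.coe_sum]
    _ = toTrop (linPart A x + b) j := rfl

lemma coeff_eq_zero_of_affEval_ne_bot {A : Matrix (Fin M) (Fin N) ℤ} {b : Vec M} {y : TropVec N}
    {i : Fin N} {j : Fin M} (hi : y i = ⊥) (hj : affEval A b y j ≠ ⊥) : A j i = 0 := by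
  by_contra h
  apply hj
  have : ∑ i, intMul (A j i) (y i) = ⊥ :=
    WithBot.sum_eq_bot_iff.2 ⟨i, Finset.mem_univ i, by simp [intMul, h, hi]⟩
  simp [affEval, this]

/-- A finite coordinate of the image cannot involve an infinite coordinate of the source, so the
differential descends to the quotients by infinite directions. -/
lemma killCoords_linPart_killCoords {A : Matrix (Fin M) (Fin N) ℤ} {b : Vec M} {y : TropVec N}
    {y' : TropVec M} (h : y' = affEval A b y) (v : Vec N) :
    killCoords (refSed y') (linPart A (killCoords (refSed y) v)) =
      killCoords (refSed y') (linPart A v) := by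
  funext j
  by_cases hj : j ∈ refSed y'
  · simp [killCoords_of_mem hj]
  rw [killCoords_of_notMem hj, killCoords_of_notMem hj]
  simp only [linPart, Matrix.toLin'_apply, Matrix.mulVec, dotProduct, Matrix.map_apply]
  refine Finset.sum_congr rfl fun i _ => ?_
  by_cases hi : i ∈ refSed y
  · rw [coeff_eq_zero_of_affEval_ne_bot (A := A) (b := b) hi (h ▸ hj)]
    simp
  · rw [killCoords_of_notMem hi]

end Affine

/-! ### Changes of charts and singular cells. -/

namespace TropicalSpace

variable {X : Type*} [TopologicalSpace X] {S : TropicalSpace X}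

lemma mem_support_of_mem {α : Fin S.numCharts} {x : X} (hx : x ∈ S.U α) :
    S.φ α x ∈ (S.Y α).support := by
  obtain ⟨O, -, hO⟩ := S.isOpen_image α
  exact (hO ▸ mem_image_of_mem _ hx : S.φ α x ∈ O ∩ (S.Y α).support).2

/-- The points of a chart near `φ_α(x)` come from any given neighbourhood of `x`. -/
lemma eventually_exists_preimage {α : Fin S.numCharts} {V : Set X} (hV : IsOpen V) {x : X}
    (hx : x ∈ V) (hU : x ∈ S.U α) :
    ∀ᶠ z in 𝓝 (S.φ α x), z ∈ (S.Y α).support → ∃ x' ∈ V, S.φ α x' = z := by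
  obtain ⟨O, hOo, hO⟩ := S.isOpen_image α
  have hxO : S.φ α x ∈ O := (hO ▸ mem_image_of_mem _ hU : S.φ α x ∈ O ∩ (S.Y α).support).1
  have h1 : (Subtype.val ⁻¹' V : Set (S.U α)) ∈ 𝓝 (⟨x, hU⟩ : S.U α) :=
    (hV.preimage continuous_subtype_val).mem_nhds hx
  rw [(S.isEmbedding α).isInducing.nhds_eq_comap] at h1
  obtain ⟨W, hW, hWV⟩ := h1
  filter_upwards [hOo.mem_nhds hxO, hW] with z hzO hzW hz
  have : z ∈ S.φ α '' S.U α := hO ▸ ⟨hzO, hz⟩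
  obtain ⟨x', hx', rfl⟩ := this
  exact ⟨x', hWV (show (⟨x', hx'⟩ : S.U α) ∈ _ from hzW), rfl⟩

/-- Two local descriptions of a change of charts have the same differential on the tangent spaces
of the adjacent facets. -/
lemma IsTransition.linPart_eq {α β : Fin S.numCharts} {V V' : Set X}
    {A A' : Matrix (Fin (S.N β)) (Fin (S.N α)) ℤ} {b b' : Vec (S.N β)}
    (h : S.IsTransition α β V A b) (h' : S.IsTransition α β V' A' b') {x : X} (hx : x ∈ V)
    (hx' : x ∈ V') {L : Submodule ℝ (Vec (S.N α))} (hL : L ∈ (S.Y α).tangentSpaces (S.φ α x))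
    {u : Vec (S.N α)} (hu : u ∈ L) : linPart A u = linPart A' u := by
  obtain ⟨D, hD, hxD, rfl⟩ := hL
  have hev := eventually_exists_preimage (h.1.inter h'.1) ⟨hx, hx'⟩ (h.2.1 hx).1
  obtain ⟨x₁, hx₁, hn⟩ := exists_isRelInt_near ((S.Y α).isRatPoly D hD) hxD
    (eventually_eventually_nhds.2 hev)
  have key : ∀ z, z ∈ D → (toTrop z ∈ (S.Y α).support →
      ∃ x' ∈ V ∩ V', S.φ α x' = toTrop z) → linPart A z + b = linPart A' z + b' := by
    intro z hz hex
    obtain ⟨x', ⟨hV, hV'⟩, hzx⟩ := hex (PolyComplex.mem_support.2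
      ⟨D, hD, subset_closure (mem_image_of_mem _ hz)⟩)
    have h1 := (h.2.2 x' hV).2
    have h2 := (h'.2.2 x' hV').2
    rw [hzx, affEval_toTrop] at h1 h2
    exact congrArg finPart (h1.symm.trans h2)
  -- The two affine maps agree at `x₁` and at `x₁ + ε u`, both in `D`; subtracting isolates the
  -- linear parts on `u`.
  have h0 := key x₁ hx₁.1 hn.self_of_nhds
  have hD' := (hx₁.2 u hu).filter_mono (nhdsWithin_le_nhds (s := Ioi 0))
  obtain ⟨ε, ⟨hεD, hε⟩, hε0⟩ := ((hD'.and
    ((PolyComplex.tendsto_toTrop_add_smul x₁ u).eventually hn)).and self_mem_nhdsWithin).exists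
  have h1 := key _ hεD hε
  rw [map_add, map_add, map_smul, map_smul] at h1
  have h2 : ε • linPart A u = ε • linPart A' u := by
    have h3 : (linPart A x₁ + ε • linPart A u + b) - (linPart A x₁ + b) =
        (linPart A' x₁ + ε • linPart A' u + b') - (linPart A' x₁ + b') := by rw [h1, h0]
    convert h3 using 1 <;> abel
  exact smul_right_injective _ (ne_of_gt hε0) h2

lemma exists_isTransition {α β : Fin S.numCharts} {x : X} (hα : x ∈ S.U α) (hβ : x ∈ S.U β) :
    ∃ V A b, S.IsTransition α β V A b ∧ x ∈ V := by
  obtain ⟨V, hV, hx, hU, A, b, h⟩ := S.compat α β x ⟨hα, hβ⟩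
  exact ⟨V, A, b, ⟨hV, hU, h⟩, hx⟩

namespace Cell

variable {q r : ℕ}

/-- A simplex in its chart. -/
def inChart (s : S.Cell q) (t : stdSimplex ℝ (Fin (q + 1))) : TropVec (S.N s.chart) :=
  S.φ s.chart (s.toMap t)

lemma continuous_inChart (s : S.Cell q) : Continuous s.inChart :=
  (S.isEmbedding s.chart).continuous.comp
    (Continuous.subtype_mk s.toMap.continuous fun t => s.mem_chart t)

lemma inChart_mem_support (s : S.Cell q) (t : stdSimplex ℝ (Fin (q + 1))) :
    s.inChart t ∈ (S.Y s.chart).support := mem_support_of_mem (s.mem_chart t)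

/-- Along an open simplex the infinite coordinates and the tangent spaces of the adjacent facets do
not change. -/
lemma inChart_openFace (s : S.Cell q) {t : stdSimplex ℝ (Fin (q + 1))} (ht : t ∈ openFace univ) :
    refSed (s.inChart t) = refSed s.pt ∧
      (S.Y s.chart).tangentSpaces (s.inChart t) = (S.Y s.chart).tangentSpaces s.pt := by
  refine isPreconnected_openFace_univ.induction₂ (fun t t' =>
    refSed (s.inChart t) = refSed (s.inChart t') ∧
      (S.Y s.chart).tangentSpaces (s.inChart t) = (S.Y s.chart).tangentSpaces (s.inChart t'))
    ?_ ?_ ?_ ht barycenter_mem_openFace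
  · intro t ht
    have h1 := (s.continuous_inChart.tendsto t).eventually
      (PolyComplex.eventually_tangentSpaces_eq (Y := S.Y s.chart) (s.inChart t))
    filter_upwards [nhdsWithin_le_nhds h1, self_mem_nhdsWithin] with t' h1 ht'
    -- The stratum fixes only two numbers; near `t` these already determine the refined sedentarity
    -- and the adjacent tangent spaces.
    obtain ⟨d, k, hj⟩ := s.strat univ t ht t' ht'
    obtain ⟨hd, hk⟩ := hj.source_mem s.chart (s.mem_chart t)
    obtain ⟨hd', hk'⟩ := hj.target_mem s.chart (s.mem_chart t')
    obtain ⟨h2, h3⟩ := h1 (s.inChart_mem_support t') (hk'.trans hk.symm) (hd'.trans hd.symm)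
    exact ⟨h2.symm, h3.symm⟩
  · exact fun _ _ _ _ _ _ h1 h2 => ⟨h1.1.trans h2.1, h1.2.trans h2.2⟩
  · exact fun _ _ _ _ h => ⟨h.1.symm, h.2.symm⟩

/-- Every point of the closed simplex is a limit of interior points, along which the data are
constant; semicontinuity gives the inclusions. -/
lemma pt_specializes (s : S.Cell q) (t : stdSimplex ℝ (Fin (q + 1))) :
    refSed s.pt ⊆ refSed (s.inChart t) ∧
      (S.Y s.chart).tangentSpaces s.pt ⊆ (S.Y s.chart).tangentSpaces (s.inChart t) := by
  have h1 := (s.continuous_inChart.tendsto t).eventually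
    ((eventually_refSed_subset (s.inChart t)).and
      (PolyComplex.eventually_tangentSpaces_subset (Y := S.Y s.chart) (s.inChart t)))
  obtain ⟨t', ht', h2, h3⟩ := exists_openFace_near t h1
  obtain ⟨h4, h5⟩ := s.inChart_openFace ht'
  exact ⟨h4 ▸ h2, h5 ▸ h3⟩

lemma refSed_pt_subset (s : S.Cell q) (f : Fin (r + 1) ↪o Fin (q + 1)) :
    refSed s.pt ⊆ refSed (s.restrict f).pt := (s.pt_specializes _).1

lemma tangentSpaces_pt_subset (s : S.Cell q) (f : Fin (r + 1) ↪o Fin (q + 1)) :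
    (S.Y s.chart).tangentSpaces s.pt ⊆ (S.Y s.chart).tangentSpaces (s.restrict f).pt :=
  (s.pt_specializes _).2

lemma restrict_restrict {d : ℕ} (s : S.Cell q) (f : Fin (r + 1) ↪o Fin (q + 1))
    (g : Fin (d + 1) ↪o Fin (r + 1)) : (s.restrict f).restrict g = s.restrict (g.trans f) := by
  have : ((s.restrict f).restrict g).toMap = (s.restrict (g.trans f)).toMap := by
    ext t
    change s.toMap (stdSimplex.map f (stdSimplex.map g t)) = s.toMap (stdSimplex.map (g.trans f) t)
    rw [stdSimplex.map_comp_apply]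
    rfl
  simp only [restrict] at this ⊢
  congr 1

lemma restrict_toMap_vertex (s : S.Cell q) (f : Fin (r + 1) ↪o Fin (q + 1)) (i : Fin (r + 1)) :
    (s.restrict f).toMap (stdSimplex.vertex i) = s.toMap (stdSimplex.vertex (f i)) := by
  change s.toMap (stdSimplex.map f (stdSimplex.vertex i)) = _
  rw [stdSimplex.map_vertex]

/-- The differentials of the change of charts at different points of a simplex coincide on the
tangent spaces of the facets adjacent to the open simplex. -/
lemma linPart_eq (s s' : S.Cell q) (hss : s.toMap = s'.toMap) {L : Submodule ℝ (Vec (S.N s.chart))}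
    (hL : L ∈ (S.Y s.chart).tangentSpaces s.pt) {u : Vec (S.N s.chart)} (hu : u ∈ L)
    {t t' : stdSimplex ℝ (Fin (q + 1))} {V V' : Set X}
    {A A' : Matrix (Fin (S.N s'.chart)) (Fin (S.N s.chart)) ℤ} {b b' : Vec (S.N s'.chart)}
    (h : S.IsTransition s.chart s'.chart V A b) (ht : s.toMap t ∈ V)
    (h' : S.IsTransition s.chart s'.chart V' A' b') (ht' : s.toMap t' ∈ V') :
    linPart A u = linPart A' u := by
  have hLt : ∀ t, L ∈ (S.Y s.chart).tangentSpaces (S.φ s.chart (s.toMap t)) := fun t =>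
    (s.pt_specializes t).2 hL
  have hex : ∀ t, ∃ V A b, S.IsTransition s.chart s'.chart V A b ∧ s.toMap t ∈ V := fun t =>
    exists_isTransition (s.mem_chart t) (hss ▸ s'.mem_chart t)
  -- Matrices may vary with the point, so the relation quantifies over all transitions at both ends;
  -- a transition at the intermediate point then gives transitivity.
  refine isPreconnected_stdSimplex.induction₂ (fun t t' =>
    ∀ (V V' : Set X) (A A' : Matrix (Fin (S.N s'.chart)) (Fin (S.N s.chart)) ℤ)
      (b b' : Vec (S.N s'.chart)), S.IsTransition s.chart s'.chart V A b → s.toMap t ∈ V →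
      S.IsTransition s.chart s'.chart V' A' b' → s.toMap t' ∈ V' → linPart A u = linPart A' u)
    ?_ ?_ ?_ (mem_univ t) (mem_univ t') V V' A A' b b' h ht h' ht'
  · intro t _
    obtain ⟨V₀, A₀, b₀, h₀, ht₀⟩ := hex t
    filter_upwards [nhdsWithin_le_nhds ((s.toMap.continuous.tendsto t).eventually
      (h₀.1.mem_nhds ht₀))] with t' ht'₀ V V' A A' b b' h ht h' ht'
    exact (h.linPart_eq h₀ ht ht₀ (hLt t) hu).trans (h₀.linPart_eq h' ht'₀ ht' (hLt t') hu)
  · intro t₁ t₂ t₃ _ _ _ h₁₂ h₂₃ V V' A A' b b' h ht h' ht'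
    obtain ⟨V₀, A₀, b₀, h₀, ht₀⟩ := hex t₂
    exact (h₁₂ _ _ _ _ _ _ h ht h₀ ht₀).trans (h₂₃ _ _ _ _ _ _ h₀ ht₀ h' ht')
  · intro t₁ t₂ _ _ h₁₂ V V' A A' b b' h ht h' ht'
    exact (h₁₂ _ _ _ _ _ _ h' ht' h ht).symm

end Cell


/-! ### Chains -/

/-- The chain `v σ`. -/
abbrev single {q : ℕ} (s : S.Cell q) : ExteriorAlgebra ℝ (Vec (S.N s.chart)) →+ S.PreChain q :=
  DirectSum.of (fun s : S.Cell q => ExteriorAlgebra ℝ (Vec (S.N s.chart))) s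

lemma single_heq {q : ℕ} {s s' : S.Cell q} (h : s = s') {v : ExteriorAlgebra ℝ (Vec (S.N s.chart))}
    {v' : ExteriorAlgebra ℝ (Vec (S.N s'.chart))} (hv : HEq v v') : single s v = single s' v' := by
  subst h
  rw [eq_of_heq hv]

lemma single_mem_chains {G : S.Coeff} {q : ℕ} {s : S.Cell q}
    {v : ExteriorAlgebra ℝ (Vec (S.N s.chart))} (hv : v ∈ G s.chart s.base) :
    single s v ∈ chains G q := by
  intro s'
  by_cases h : s = s'
  · subst h
    simpa [DirectSum.of_eq_same] using hv
  · rw [DirectSum.of_eq_of_ne _ _ _ (Ne.symm h)]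
    exact zero_mem _

lemma map_mem_of_mem_chains {B : Type*} [AddCommGroup B] {G : S.Coeff} {q : ℕ}
    (F : S.PreChain q →+ B) (K : AddSubgroup B)
    (h : ∀ s : S.Cell q, ∀ v ∈ G s.chart s.base, F (single s v) ∈ K) {c : S.PreChain q}
    (hc : c ∈ chains G q) : F c ∈ K := by
  classical
  rw [← DirectSum.sum_support_of c, map_sum]
  exact sum_mem fun s _ => h s _ (hc s)

/-! ### Faces of a simplex written in its own chart. -/

namespace Cell

variable {q r d : ℕ}

/-- The base point of the face `f`, in the chart of the simplex. -/
def facePt (s : S.Cell q) (f : Fin (r + 1) ↪o Fin (q + 1)) : TropVec (S.N s.chart) :=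
  (s.restrict f).pt

/-- The projection of the coefficients to the tangent space at the face `f`. -/
def faceProj (s : S.Cell q) (f : Fin (r + 1) ↪o Fin (q + 1)) :
    ExteriorAlgebra ℝ (Vec (S.N s.chart)) →ₐ[ℝ] ExteriorAlgebra ℝ (Vec (S.N s.chart)) :=
  ExteriorAlgebra.map (killCoords (refSed (s.facePt f)))

/-- The value of a cochain on the face `g`, in the chart of the simplex. -/
def faceValue (a : ∀ s : S.Cell d, Vec (S.N s.chart)) (s : S.Cell q)
    (g : Fin (d + 1) ↪o Fin (q + 1)) : Vec (S.N s.chart) :=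
  a (s.restrict g)

/-- The chain `v σ` pushed to the face `f` of `σ`. -/
def push (s : S.Cell q) (f : Fin (r + 1) ↪o Fin (q + 1)) :
    ExteriorAlgebra ℝ (Vec (S.N s.chart)) →+ S.PreChain r :=
  (single (s.restrict f)).comp (s.restrict f).project

lemma push_apply (s : S.Cell q) (f : Fin (r + 1) ↪o Fin (q + 1))
    (v : ExteriorAlgebra ℝ (Vec (S.N s.chart))) :
    s.push f v = single (s.restrict f) (s.faceProj f v) := rfl

lemma refSed_pt_subset_facePt (s : S.Cell q) (f : Fin (r + 1) ↪o Fin (q + 1)) :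
    refSed s.pt ⊆ refSed (s.facePt f) := s.refSed_pt_subset f

lemma facePt_restrict (s : S.Cell q) (f : Fin (r + 1) ↪o Fin (q + 1))
    (g : Fin (d + 1) ↪o Fin (r + 1)) : (s.restrict f).facePt g = s.facePt (g.trans f) :=
  eq_of_heq (congr_arg_heq (fun s : S.Cell d => s.pt) (restrict_restrict s f g))

lemma faceValue_restrict (a : ∀ s : S.Cell d, Vec (S.N s.chart)) (s : S.Cell q)
    (f : Fin (r + 1) ↪o Fin (q + 1)) (g : Fin (d + 1) ↪o Fin (r + 1)) :
    faceValue a (s.restrict f) g = faceValue a s (g.trans f) :=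
  eq_of_heq (congr_arg_heq a (restrict_restrict s f g))

lemma refSed_facePt_subset (s : S.Cell q) (f : Fin (r + 1) ↪o Fin (q + 1))
    (g : Fin (d + 1) ↪o Fin (r + 1)) :
    refSed (s.facePt f) ⊆ refSed (s.facePt (g.trans f)) := by
  have h := (s.restrict f).refSed_pt_subset_facePt g
  rw [facePt_restrict] at h
  exact h

lemma faceProj_of_subset (s : S.Cell q) (f : Fin (r + 1) ↪o Fin (q + 1))
    {I : Set (Fin (S.N s.chart))} (h : I ⊆ refSed (s.facePt f))
    (v : ExteriorAlgebra ℝ (Vec (S.N s.chart))) :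
    s.faceProj f (ExteriorAlgebra.map (killCoords I) v) = s.faceProj f v := by
  rw [faceProj, ← AlgHom.comp_apply, ExteriorAlgebra.map_comp_map]
  congr 2
  exact LinearMap.ext fun x => killCoords_killCoords h x

lemma faceProj_ι (s : S.Cell q) (f : Fin (r + 1) ↪o Fin (q + 1)) (u : Vec (S.N s.chart)) :
    s.faceProj f (ExteriorAlgebra.ι ℝ u) =
      ExteriorAlgebra.ι ℝ (killCoords (refSed (s.facePt f)) u) :=
  ExteriorAlgebra.map_apply_ι _ _

lemma push_restrict (s : S.Cell q) (f : Fin (r + 1) ↪o Fin (q + 1))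
    (g : Fin (d + 1) ↪o Fin (r + 1)) (v : ExteriorAlgebra ℝ (Vec (S.N s.chart))) :
    (s.restrict f).push g v = s.push (g.trans f) v := by
  refine single_heq (restrict_restrict s f g) (heq_of_eq ?_)
  exact congrArg (fun y : TropVec (S.N s.chart) =>
    ExteriorAlgebra.map (killCoords (refSed y)) v) (facePt_restrict s f g)

lemma push_congr (s : S.Cell q) (f : Fin (r + 1) ↪o Fin (q + 1))
    {v w : ExteriorAlgebra ℝ (Vec (S.N s.chart))} (h : s.faceProj f v = s.faceProj f w) :
    s.push f v = s.push f w := by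
  rw [push_apply, push_apply, h]

lemma faceProj_faceProj (s : S.Cell q) (f : Fin (r + 1) ↪o Fin (q + 1))
    (g : Fin (d + 1) ↪o Fin (r + 1)) (v : ExteriorAlgebra ℝ (Vec (S.N s.chart))) :
    s.faceProj (g.trans f) (s.faceProj f v) = s.faceProj (g.trans f) v :=
  s.faceProj_of_subset _ (s.refSed_facePt_subset f g) v

end Cell

/-- The boundary of `v σ`. -/
lemma boundary_single {q : ℕ} (s : S.Cell (q + 1)) (v : ExteriorAlgebra ℝ (Vec (S.N s.chart))) :
    S.boundary q (single s v) =
      ∑ i : Fin (q + 2), (-1 : ℤ) ^ (i : ℕ) • s.push (Fin.succAboveOrderEmb i) v := by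
  rw [boundary, DirectSum.toAddMonoid_of]
  exact AddMonoidHom.finsetSum_apply
    (fun i : Fin (q + 2) => (-1 : ℤ) ^ (i : ℕ) • s.push (Fin.succAboveOrderEmb i)) _ v

/-- The boundary of the chain `v σ` pushed to a face. -/
lemma boundary_push {q r : ℕ} (s : S.Cell q) (f : Fin (r + 2) ↪o Fin (q + 1))
    (v : ExteriorAlgebra ℝ (Vec (S.N s.chart))) :
    S.boundary r (s.push f v) = ∑ i : Fin (r + 2), (-1 : ℤ) ^ (i : ℕ) •
      s.push ((Fin.succAboveOrderEmb i).trans f) v := by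
  refine (boundary_single (s.restrict f) (s.faceProj f v)).trans ?_
  refine Finset.sum_congr rfl fun i _ => congrArg (fun c => (-1 : ℤ) ^ (i : ℕ) • c) ?_
  exact (s.push_restrict f _ _).trans (s.push_congr _ (s.faceProj_faceProj f _ v))

/-! ### Products of chains with wave cochains. -/

section Cap

variable {q r d k : ℕ}

open Cell

/-- The product of a chain with a cochain `a`, where `a` is evaluated on the face `g` of a simplex and
the result is pushed to its face `f`. -/
def capFaces (a : ∀ s : S.Cell d, Vec (S.N s.chart)) (f : Fin (r + 1) ↪o Fin (q + 1))
    (g : Fin (d + 1) ↪o Fin (q + 1)) : S.PreChain q →+ S.PreChain r :=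
  DirectSum.toAddMonoid fun s =>
    (s.push f).comp (AddMonoidHom.mulLeft (ExteriorAlgebra.ι ℝ (faceValue a s g)))

lemma capFaces_single (a : ∀ s : S.Cell d, Vec (S.N s.chart)) (f : Fin (r + 1) ↪o Fin (q + 1))
    (g : Fin (d + 1) ↪o Fin (q + 1)) (s : S.Cell q)
    (v : ExteriorAlgebra ℝ (Vec (S.N s.chart))) :
    capFaces a f g (single s v) = s.push f (ExteriorAlgebra.ι ℝ (faceValue a s g) * v) := by
  rw [capFaces, DirectSum.toAddMonoid_of]
  rfl

lemma capFaces_push {m : ℕ} (a : ∀ s : S.Cell d, Vec (S.N s.chart))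
    (f : Fin (r + 1) ↪o Fin (q + 1)) (g : Fin (d + 1) ↪o Fin (q + 1)) (s : S.Cell m)
    (h : Fin (q + 1) ↪o Fin (m + 1)) (v : ExteriorAlgebra ℝ (Vec (S.N s.chart))) :
    capFaces a f g (s.push h v) =
      s.push (f.trans h) (ExteriorAlgebra.ι ℝ (faceValue a s (g.trans h)) * v) := by
  refine (capFaces_single a f g (s.restrict h) (s.faceProj h v)).trans ?_
  refine Eq.trans (congrArg (fun u : Vec (S.N s.chart) => (s.restrict h).push f
    (ExteriorAlgebra.ι ℝ u * s.faceProj h v : ExteriorAlgebra ℝ (Vec (S.N s.chart))))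
      (faceValue_restrict a s h g)) ?_
  refine (s.push_restrict h f _).trans (s.push_congr _ ?_)
  rw [map_mul, map_mul, faceProj_faceProj]

/-- The cap product with a `1`-cochain in terms of faces. -/
lemma cap_eq_capFaces (a : ∀ s : S.Cell 1, Vec (S.N s.chart)) (q : ℕ) :
    cap a q = capFaces a (Fin.succAboveOrderEmb 0)
      (Fin.castLEOrderEmb (by omega : 1 + 1 ≤ q + 1 + 1)) := by
  refine DirectSum.addHom_ext fun s v => ?_
  refine Eq.trans ?_ (capFaces_single _ _ _ s v).symm
  rw [cap, DirectSum.toAddMonoid_of]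
  -- The projection at the simplex is absorbed by the larger one at its face.
  refine s.push_congr (Fin.succAboveOrderEmb 0) (v := ExteriorAlgebra.ι ℝ (killCoords (refSed s.pt)
    (faceValue a s (Fin.castLEOrderEmb (by omega : 1 + 1 ≤ q + 1 + 1)))) * v) ?_
  rw [map_mul, map_mul, faceProj_ι, faceProj_ι,
    killCoords_killCoords (s.refSed_pt_subset_facePt _)]

lemma capFaces_add (a b : ∀ s : S.Cell d, Vec (S.N s.chart)) (f : Fin (r + 1) ↪o Fin (q + 1))
    (g : Fin (d + 1) ↪o Fin (q + 1)) :
    capFaces (fun s => a s + b s) f g = capFaces a f g + capFaces b f g := by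
  refine DirectSum.addHom_ext fun s v => ?_
  change capFaces _ f g (single s v) = capFaces a f g (single s v) + capFaces b f g (single s v)
  have : faceValue (fun s => a s + b s) s g = faceValue a s g + faceValue b s g := rfl
  rw [capFaces_single, capFaces_single, capFaces_single, this, map_add, add_mul, map_add]

/-- Tangent spaces adjacent to the open simplex remain adjacent at its face `g`, and the wave space
there lies in each of them. -/
lemma mem_of_mem_tangentSpaces {a : ∀ s : S.Cell d, Vec (S.N s.chart)} (ha : S.IsWaveCochain a)
    (s : S.Cell q) (g : Fin (d + 1) ↪o Fin (q + 1)) {L : Submodule ℝ (Vec (S.N s.chart))}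
    (hL : L ∈ (S.Y s.chart).tangentSpaces s.pt) : faceValue a s g ∈ L :=
  PolyComplex.waveSpace_le_of_mem_tangentSpaces (s.tangentSpaces_pt_subset g hL)
    (ha.1 (s.restrict g))

lemma faceProj_ι_mul_mem_FR {a : ∀ s : S.Cell d, Vec (S.N s.chart)} (ha : S.IsWaveCochain a)
    (f : Fin (r + 1) ↪o Fin (q + 1)) (g : Fin (d + 1) ↪o Fin (q + 1)) (s : S.Cell q)
    {v : ExteriorAlgebra ℝ (Vec (S.N s.chart))} (hv : v ∈ S.FZ k s.chart s.base) :
    s.faceProj f (ExteriorAlgebra.ι ℝ (faceValue a s g) * v) ∈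
      S.FR (k + 1) s.chart (s.restrict f).base := by
  have h1 := PolyComplex.ι_mul_mem_coeffR (k := k) (y := s.pt)
    (fun L hL => mem_of_mem_tangentSpaces ha s g hL) hv
  have h2 : s.faceProj f (ExteriorAlgebra.ι ℝ (killCoords (refSed s.pt) (faceValue a s g)) * v) ∈
      S.FR (k + 1) s.chart (s.restrict f).base :=
    PolyComplex.map_mem_coeffR (s.refSed_pt_subset f) (s.tangentSpaces_pt_subset f) h1
  rw [map_mul, faceProj_ι, killCoords_killCoords (s.refSed_pt_subset_facePt _)] at h2
  rwa [map_mul, faceProj_ι]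

lemma capFaces_mem_chains {a : ∀ s : S.Cell d, Vec (S.N s.chart)} (ha : S.IsWaveCochain a)
    (f : Fin (r + 1) ↪o Fin (q + 1)) (g : Fin (d + 1) ↪o Fin (q + 1)) {c : S.PreChain q}
    (hc : c ∈ chains (S.FZ k) q) : capFaces a f g c ∈ chains (S.FR (k + 1)) r := by
  refine map_mem_of_mem_chains _ _ (fun s v hv => ?_) hc
  rw [capFaces_single]
  exact single_mem_chains (faceProj_ι_mul_mem_FR ha f g s hv)

lemma facePt_eq_affEval {s s' : S.Cell q} (hss : s.toMap = s'.toMap)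
    (f : Fin (r + 1) ↪o Fin (q + 1)) {V : Set X}
    {A : Matrix (Fin (S.N s'.chart)) (Fin (S.N s.chart)) ℤ} {b : Vec (S.N s'.chart)}
    (h : S.IsTransition s.chart s'.chart V A b) (hV : (s.restrict f).base ∈ V) :
    s'.facePt f = affEval A b (s.facePt f) := by
  have h1 : (s.restrict f).base = (s'.restrict f).base :=
    congrArg (fun F : C(_, X) => F (stdSimplex.map f stdSimplex.barycenter)) hss
  refine Eq.trans ?_ (h.2.2 _ hV).2
  rw [h1]
  rfl

lemma pt_eq_affEval {s s' : S.Cell q} (hss : s.toMap = s'.toMap) {V : Set X}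
    {A : Matrix (Fin (S.N s'.chart)) (Fin (S.N s.chart)) ℤ} {b : Vec (S.N s'.chart)}
    (h : S.IsTransition s.chart s'.chart V A b) (hV : s.base ∈ V) :
    s'.pt = affEval A b s.pt := by
  have h1 : s.base = s'.base := congrArg (fun F : C(_, X) => F stdSimplex.barycenter) hss
  refine Eq.trans ?_ (h.2.2 _ hV).2
  rw [h1]
  rfl

/-- The differentials of the change of charts at a simplex and at its face agree on coefficients,
modulo the infinite directions at the face. -/
lemma map_linPart_eq {s s' : S.Cell q} (hss : s.toMap = s'.toMap) (f : Fin (r + 1) ↪o Fin (q + 1))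
    {V V' : Set X} {A A' : Matrix (Fin (S.N s'.chart)) (Fin (S.N s.chart)) ℤ}
    {b b' : Vec (S.N s'.chart)} (h : S.IsTransition s.chart s'.chart V A b) (hV : s.base ∈ V)
    (h' : S.IsTransition s.chart s'.chart V' A' b') (hV' : (s.restrict f).base ∈ V')
    {v : ExteriorAlgebra ℝ (Vec (S.N s.chart))} (hv : v ∈ S.FZ k s.chart s.base) :
    ExteriorAlgebra.map (killCoords (refSed (s'.facePt f)) ∘ₗ linPart A) v =
      ExteriorAlgebra.map (killCoords (refSed (s'.facePt f)) ∘ₗ linPart A') v := by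
  have hpt := pt_eq_affEval hss h hV
  have hptf := facePt_eq_affEval hss f h' hV'
  refine PolyComplex.coeffZ_induction (P := fun v =>
    ExteriorAlgebra.map (killCoords (refSed (s'.facePt f)) ∘ₗ linPart A) v =
      ExteriorAlgebra.map (killCoords (refSed (s'.facePt f)) ∘ₗ linPart A') v)
    ?_ (by simp) (fun a b ha hb => by rw [map_add, map_add, ha, hb])
    (fun a ha => by rw [map_neg, map_neg, ha]) hv
  intro L hL v hv
  rw [ExteriorAlgebra.map_apply_ιMulti, ExteriorAlgebra.map_apply_ιMulti]
  congr 1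
  funext j
  obtain ⟨l, hl, hlv⟩ := (hv j).2
  have h1 : linPart A l = linPart A' l := s.linPart_eq s' hss hL hl h hV h' hV'
  simp only [Function.comp_apply, LinearMap.comp_apply, ← hlv]
  calc killCoords (refSed (s'.facePt f)) (linPart A (killCoords (refSed s.pt) l))
      = killCoords (refSed (s'.facePt f)) (killCoords (refSed s'.pt)
          (linPart A (killCoords (refSed s.pt) l))) :=
        (killCoords_killCoords (s'.refSed_pt_subset_facePt f) _).symm
    _ = killCoords (refSed (s'.facePt f)) (linPart A l) := by
        rw [killCoords_linPart_killCoords hpt,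
          killCoords_killCoords (s'.refSed_pt_subset_facePt f)]
    _ = killCoords (refSed (s'.facePt f)) (linPart A' (killCoords (refSed (s.facePt f))
          (killCoords (refSed s.pt) l))) := by
        rw [h1, killCoords_killCoords (s.refSed_pt_subset_facePt f),
          killCoords_linPart_killCoords hptf]
    _ = _ := killCoords_linPart_killCoords hptf _

/-- The cap product with a wave cochain respects the identification of the coefficients over
different charts. -/
lemma capFaces_mem_chartRel {a : ∀ s : S.Cell d, Vec (S.N s.chart)} (ha : S.IsWaveCochain a)
    (f : Fin (r + 1) ↪o Fin (q + 1)) (g : Fin (d + 1) ↪o Fin (q + 1)) {c : S.PreChain q}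
    (hc : c ∈ chartRel (S.FZ k) q) : capFaces a f g c ∈ chartRel (S.FR (k + 1)) r := by
  suffices h : chartRel (S.FZ k) q ≤ (chartRel (S.FR (k + 1)) r).comap (capFaces a f g) from h hc
  refine (AddSubgroup.closure_le _).2 ?_
  rintro _ ⟨s, s', v, v', hss, hv, hv', ⟨V, A, b, htr, hV, hvv'⟩, rfl⟩
  have hmem : ∀ t, s.toMap t ∈ S.U s'.chart := fun t => hss ▸ s'.mem_chart t
  have hres : ∀ {m : ℕ} (k : Fin (m + 1) ↪o Fin (q + 1)),
      (s.restrict k).toMap = (s'.restrict k).toMap := fun k => by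
    ext t; exact congrArg (fun F : C(_, X) => F (stdSimplex.map k t)) hss
  -- `A₁` acts at the face `f` that carries the result, `A₂` at the face `g` where the cochain is
  -- evaluated, and `A` at the simplex; they agree on the tangent spaces adjacent to the open
  -- simplex.
  obtain ⟨V₁, A₁, b₁, htr₁, hV₁⟩ := exists_isTransition (S := S) (α := s.chart) (β := s'.chart)
    (x := (s.restrict f).base) (s.mem_chart _) (hmem _)
  obtain ⟨V₂, A₂, b₂, htr₂, hV₂⟩ := exists_isTransition (S := S) (α := s.chart) (β := s'.chart)
    (x := (s.restrict g).base) (s.mem_chart _) (hmem _)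
  obtain ⟨D, hD, hsD⟩ := PolyComplex.mem_support.1 (s.inChart_mem_support stdSimplex.barycenter)
  have hL : vectorSpan ℝ D ∈ (S.Y s.chart).tangentSpaces s.pt := ⟨D, hD, hsD, rfl⟩
  have ha' : faceValue a s' g = linPart A₁ (faceValue a s g) :=
    (ha.2 (s.restrict g) (s'.restrict g) (hres g) V₂ A₂ b₂ htr₂ hV₂).trans
      (s.linPart_eq s' hss hL (mem_of_mem_tangentSpaces ha s g hL) htr₂ hV₂ htr₁ hV₁)
  have hptf := facePt_eq_affEval hss f htr₁ hV₁
  change capFaces a f g (single s v - single s' v') ∈ chartRel (S.FR (k + 1)) r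
  rw [map_sub, capFaces_single, capFaces_single]
  refine AddSubgroup.subset_closure ⟨s.restrict f, s'.restrict f,
    s.faceProj f (ExteriorAlgebra.ι ℝ (faceValue a s g) * v),
    s'.faceProj f (ExteriorAlgebra.ι ℝ (faceValue a s' g) * v'), hres f,
    faceProj_ι_mul_mem_FR ha f g s hv, faceProj_ι_mul_mem_FR ha f g s' hv',
    ⟨V₁, A₁, b₁, htr₁, hV₁, ?_⟩, rfl⟩
  change s'.faceProj f (ExteriorAlgebra.ι ℝ (faceValue a s' g) * v') =
    ExteriorAlgebra.map (killCoords (refSed (s'.facePt f)) ∘ₗ linPart A₁)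
      (s.faceProj f (ExteriorAlgebra.ι ℝ (faceValue a s g) * v))
  have hcomp : (killCoords (refSed (s'.facePt f)) ∘ₗ linPart A₁) ∘ₗ
      killCoords (refSed (s.facePt f)) = killCoords (refSed (s'.facePt f)) ∘ₗ linPart A₁ :=
    LinearMap.ext fun x => killCoords_linPart_killCoords hptf x
  have hcomp' : killCoords (refSed (s'.facePt f)) ∘ₗ killCoords (refSed s'.pt) ∘ₗ linPart A =
      killCoords (refSed (s'.facePt f)) ∘ₗ linPart A :=
    LinearMap.ext fun x => killCoords_killCoords (s'.refSed_pt_subset_facePt f) _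
  rw [faceProj, faceProj, ← AlgHom.comp_apply (ExteriorAlgebra.map _) (ExteriorAlgebra.map _),
    ExteriorAlgebra.map_comp_map, hcomp, map_mul, map_mul, ExteriorAlgebra.map_apply_ι,
    ExteriorAlgebra.map_apply_ι, ha', hvv', ← AlgHom.comp_apply, ExteriorAlgebra.map_comp_map,
    hcomp', map_linPart_eq hss f htr hV htr₁ hV₁ hv]
  rfl

end Cap


open Cell

/-! ### The cap product with a `1`-cocycle -/

/-- The inclusion of the vertex `i`. -/
def vertexEmb {q : ℕ} (i : Fin (q + 1)) : Fin (0 + 1) ↪o Fin (q + 1) :=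
  OrderEmbedding.ofStrictMono (fun _ => i) (Subsingleton.strictMono (α := Fin 1) _)

lemma succAbove_trans_succAbove {q : ℕ} (k : Fin (q + 2)) :
    (Fin.succAboveOrderEmb (0 : Fin (q + 2))).trans (Fin.succAboveOrderEmb k.succ) =
      (Fin.succAboveOrderEmb k).trans (Fin.succAboveOrderEmb (0 : Fin (q + 3))) := by
  refine DFunLike.ext _ _ fun x => ?_
  simp

/-- The cap product with a cocycle anticommutes with the boundary. -/
lemma cap_boundary {a : ∀ s : S.Cell 1, Vec (S.N s.chart)} {q : ℕ}
    (F : ∀ s : S.Cell (q + 2), Fin (q + 3) → Vec (S.N s.chart))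
    (ha : ∀ (s : S.Cell (q + 2)) (g : Fin (1 + 1) ↪o Fin (q + 3)),
      faceValue a s g = F s (g 1) - F s (g 0)) (c : S.PreChain (q + 2)) :
    cap a q (S.boundary (q + 1) c) = -S.boundary q (cap a (q + 1) c) := by
  have key : (cap a q).comp (S.boundary (q + 1)) = -(S.boundary q).comp (cap a (q + 1)) := by
    refine DirectSum.addHom_ext fun s v => ?_
    change cap a q (S.boundary (q + 1) (single s v)) = -S.boundary q (cap a (q + 1) (single s v))
    rw [cap_eq_capFaces, cap_eq_capFaces, boundary_single, capFaces_single, boundary_push, map_sum]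
    simp only [map_zsmul, capFaces_push]
    -- The faces opposite the vertices `0` and `1` both lead to the face spanned by the vertices
    -- from `2` on, where `a₁₂ - a₀₂ = -a₀₁`. The other faces keep the edge `01` and match term by
    -- term.
    rw [Fin.sum_univ_succ, Fin.sum_univ_succ, Fin.sum_univ_succ (n := q + 1), neg_add,
      ← Finset.sum_neg_distrib, ← add_assoc]
    congr 1
    · have h1 : (Fin.succAboveOrderEmb (0 : Fin (q + 2))).trans
          (Fin.succAboveOrderEmb (Fin.succ (0 : Fin (q + 2)))) =
          (Fin.succAboveOrderEmb (0 : Fin (q + 2))).trans (Fin.succAboveOrderEmb 0) :=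
        succAbove_trans_succAbove 0
      rw [h1]
      simp only [Fin.val_zero, pow_zero, one_smul, Fin.val_succ, zero_add, pow_one, neg_smul]
      rw [← sub_eq_add_neg, ← map_sub, ← sub_mul, ← map_sub, ← map_neg, ← neg_mul, ← map_neg,
        ha, ha, ha]
      congr 3
      change (F s 2 - F s 1) - (F s 2 - F s 0) = -(F s 1 - F s 0)
      abel
    · refine Finset.sum_congr rfl fun k _ => ?_
      have h2 : (Fin.castLEOrderEmb (by omega : 1 + 1 ≤ q + 1 + 1)).trans
          (Fin.succAboveOrderEmb k.succ.succ) =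
          Fin.castLEOrderEmb (by omega : 1 + 1 ≤ q + 1 + 1 + 1) := by
        refine DFunLike.ext _ _ fun x => ?_
        fin_cases x
        · rfl
        · rfl
      rw [succAbove_trans_succAbove, h2]
      simp [pow_succ]
  exact DFunLike.congr_fun key c

lemma faceValue_coboundaryZero (e : ∀ s : S.Cell 0, Vec (S.N s.chart)) {q : ℕ} (s : S.Cell q)
    (g : Fin (1 + 1) ↪o Fin (q + 1)) :
    faceValue (coboundaryZero e) s g =
      faceValue e s (vertexEmb (g 1)) - faceValue e s (vertexEmb (g 0)) := by
  have h : ∀ i : Fin 2, (Fin.succAboveOrderEmb i : Fin (0 + 1) ↪o Fin (0 + 2)).trans g =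
      vertexEmb (g (i.succAbove 0)) := by
    intro i
    refine DFunLike.ext _ _ fun x => ?_
    rw [Subsingleton.elim (α := Fin 1) x 0]
    rfl
  have h0 := faceValue_restrict e s g (Fin.succAboveOrderEmb 0)
  have h1 := faceValue_restrict e s g (Fin.succAboveOrderEmb 1)
  rw [h] at h0 h1
  exact congrArg₂ (fun u v : Vec (S.N s.chart) => u - v) h0 h1

/-- The cap product with a coboundary is homotopic to zero. -/
lemma cap_coboundaryZero (e : ∀ s : S.Cell 0, Vec (S.N s.chart)) {q : ℕ} (c : S.PreChain (q + 1)) :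
    cap (coboundaryZero e) q c =
      capFaces e (RelEmbedding.refl _) (vertexEmb 0) (S.boundary q c) -
        S.boundary q (capFaces e (RelEmbedding.refl _) (vertexEmb 0) c) := by
  have key : cap (coboundaryZero e) q =
      (capFaces e (RelEmbedding.refl _) (vertexEmb 0)).comp (S.boundary q) -
        (S.boundary q).comp (capFaces e (RelEmbedding.refl _) (vertexEmb 0)) := by
    refine DirectSum.addHom_ext fun s v => ?_
    change cap (coboundaryZero e) q (single s v) =
      capFaces e (RelEmbedding.refl _) (vertexEmb 0) (S.boundary q (single s v)) -
        S.boundary q (capFaces e (RelEmbedding.refl _) (vertexEmb 0) (single s v))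
    have h1 : ∀ i : Fin (q + 2), (RelEmbedding.refl _ : Fin (q + 1) ↪o Fin (q + 1)).trans
        (Fin.succAboveOrderEmb i) = Fin.succAboveOrderEmb i := fun i => rfl
    have h2 : ∀ i : Fin (q + 2), (Fin.succAboveOrderEmb i).trans
        (RelEmbedding.refl _ : Fin (q + 2) ↪o Fin (q + 2)) = Fin.succAboveOrderEmb i := fun i => rfl
    have h3 : ∀ i : Fin (q + 2), (vertexEmb (0 : Fin (q + 1))).trans (Fin.succAboveOrderEmb i) =
        vertexEmb (i.succAbove 0) := fun i => rfl
    rw [cap_eq_capFaces, boundary_single, capFaces_single, capFaces_single, boundary_push, map_sum]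
    simp only [map_zsmul, capFaces_push, h1, h2, h3]
    -- Only the face opposite the vertex `0` has a different first vertex; all other terms cancel.
    rw [Fin.sum_univ_succ, Fin.sum_univ_succ (n := q + 1), faceValue_coboundaryZero]
    simp only [Fin.succ_succAbove_zero, add_sub_add_right_eq_sub]
    simp only [Fin.val_zero, pow_zero, one_smul]
    rw [← map_sub, ← sub_mul, ← map_sub]
    rfl
  exact DFunLike.congr_fun key c

/-- The eigenwave is a difference of functions of the vertices. -/
lemma faceValue_liftDiff (y : X → X) {q : ℕ} (s : S.Cell q) (g : Fin (1 + 1) ↪o Fin (q + 1)) :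
    faceValue (liftDiff y) s g =
      finPart (S.φ s.chart (y (s.toMap (stdSimplex.vertex (g 1))))) -
        finPart (S.φ s.chart (y (s.toMap (stdSimplex.vertex (g 0))))) := by
  rw [← restrict_toMap_vertex s g, ← restrict_toMap_vertex s g]
  rfl

/-! ### Straight cycles -/

/-- The product of `p + 1` vectors of a `p`-dimensional space. -/
lemma ι_mul_ιMulti_eq_zero {N p : ℕ} {L : Submodule ℝ (Vec N)} (hL : Module.finrank ℝ L = p)
    {b : Fin p → Vec N} (hb : ∀ i, b i ∈ L) {u : Vec N} (hu : u ∈ L) :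
    ExteriorAlgebra.ι ℝ u * ExteriorAlgebra.ιMulti ℝ p b = 0 := by
  have h := ExteriorAlgebra.ιMulti_succ_apply (R := ℝ) (Matrix.vecCons u b)
  have h0 : ExteriorAlgebra.ιMulti ℝ (p + 1) (Matrix.vecCons u b) = 0 := by
    refine AlternatingMap.map_linearDependent _ _ fun hli => ?_
    have h1 := finrank_span_eq_card hli
    have h2 : Submodule.span ℝ (range (Matrix.vecCons u b)) ≤ L := by
      rw [Submodule.span_le]
      rintro _ ⟨i, rfl⟩
      refine Fin.cases hu (fun i => ?_) i
      exact hb i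
    have h3 := Submodule.finrank_mono h2
    rw [Fintype.card_fin] at h1
    omega
  rw [h0] at h
  simpa using h.symm

lemma Cell.inChart_mem_domain {q : ℕ} (s : S.Cell q) {D : Set (Vec (S.N s.chart))}
    (hD : ∀ t ∈ openFace univ, s.inChart t ∈ domain D) (t : stdSimplex ℝ (Fin (q + 1))) :
    s.inChart t ∈ domain D := by
  by_contra h
  obtain ⟨t', ht', h'⟩ := exists_openFace_near t
    ((s.continuous_inChart.tendsto t).eventually (isClosed_closure.isOpen_compl.mem_nhds h))
  exact h' (hD t' ht')

/-- At each simplex of a straight cycle, the eigenwave is tangent to the cycle; hence its product with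
the volume element vanishes. -/
lemma cap_liftDiff_fundamentalChain {p : ℕ} {Z : S.StraightCycle (p + 1)} {c : S.PreChain (p + 1)}
    (hc : IsFundamentalChain Z c) {y : X → X} (hy : S.IsMobileLift y) :
    cap (liftDiff y) p c = 0 := by
  obtain ⟨K, cell, vol, -, hfacet, rfl⟩ := hc
  rw [map_sum]
  refine Finset.sum_eq_zero fun s _ => ?_
  rw [map_zsmul, cap_eq_capFaces, capFaces_single]
  obtain ⟨D, hD, hint, ⟨b, -, hb, -, hvol⟩, -⟩ := hfacet s
  have hreg := (Z.model (cell s).chart).isRegularPoly hD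
  have hdom := (cell s).inChart_mem_domain (D := D) fun t ht => by
    obtain ⟨x, hx, hxt⟩ := hint t ht
    exact subset_closure ⟨x, intrinsicInterior_subset hx, hxt⟩
  have hmem : faceValue (liftDiff y) (cell s)
      (Fin.castLEOrderEmb (by omega : 1 + 1 ≤ p + 1 + 1)) ∈ vectorSpan ℝ D := by
    obtain ⟨d, hd⟩ := hreg.nonempty
    -- The lift of a vertex need not lie in `D`. It has the same finite coordinates as the vertex,
    -- and the infinite directions are tangent to `D`.
    have hv : ∀ i, finPart (S.φ (cell s).chart (y ((cell s).toMap (stdSimplex.vertex i)))) - d ∈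
        vectorSpan ℝ D := fun i =>
      hreg.sub_mem_vectorSpan (hdom (stdSimplex.vertex i)) (fun j hj => by
        have h := (hy.1 _ _ ((cell s).mem_chart (stdSimplex.vertex i))).2 j hj
        rw [finPart, h]
        rfl) hd
    rw [faceValue_liftDiff]
    simpa using sub_mem (hv _) (hv _)
  rw [hvol, ι_mul_ιMulti_eq_zero ((Z.model (cell s).chart).dim_eq D hD) (fun i => (hb i).2) hmem,
    map_zero, smul_zero]

/-! ### The cap product with the eigenwave on homology, and straight classes. -/

section Eigenwave

variable {a : ∀ s : S.Cell 1, Vec (S.N s.chart)}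

/-- Within one simplex the cochain is the difference of a function of the vertices: the coordinates
of the lift plus the value of `e`. The lift coordinates need not be wave vectors, so this does not
make the eigenwave a coboundary in the wave complex. -/
lemma RepresentsEigenwave.cap_boundary (ha : RepresentsEigenwave a) {q : ℕ}
    (c : S.PreChain (q + 2)) :
    cap a q (S.boundary (q + 1) c) = -S.boundary q (cap a (q + 1) c) := by
  obtain ⟨-, y, -, e, -, hae⟩ := ha
  refine TropicalSpace.cap_boundary (fun s i =>
    finPart (S.φ s.chart (y (s.toMap (stdSimplex.vertex i)))) + faceValue e s (vertexEmb i))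
    (fun s g => ?_) c
  have h : faceValue a s g = faceValue (liftDiff y) s g + faceValue (coboundaryZero e) s g :=
    hae (s.restrict g)
  rw [h, faceValue_liftDiff, faceValue_coboundaryZero]
  abel

lemma cap_mem_chains (ha : S.IsWaveCochain a) {k q : ℕ} {c : S.PreChain (q + 1)}
    (hc : c ∈ chains (S.FZ k) (q + 1)) : cap a q c ∈ chains (S.FR (k + 1)) q := by
  rw [cap_eq_capFaces]
  exact capFaces_mem_chains ha _ _ hc

lemma cap_mem_chartRel (ha : S.IsWaveCochain a) {k q : ℕ} {c : S.PreChain (q + 1)}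
    (hc : c ∈ chartRel (S.FZ k) (q + 1)) : cap a q c ∈ chartRel (S.FR (k + 1)) q := by
  rw [cap_eq_capFaces]
  exact capFaces_mem_chartRel ha _ _ hc

/-- The cap product with the eigenwave is defined on cycles. -/
lemma RepresentsEigenwave.cap_mem_cycles (ha : RepresentsEigenwave a) {k q : ℕ}
    {c : S.PreChain (q + 1)} (hc : c ∈ cycles (S.FZ k) (q + 1)) :
    cap a q c ∈ cycles (S.FR (k + 1)) q := by
  cases q with
  | zero => exact cap_mem_chains ha.1 hc.1
  | succ q =>
    refine ⟨cap_mem_chains ha.1 hc.1, ?_⟩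
    change S.boundary q (cap a (q + 1) c) ∈ chartRel (S.FR (k + 1)) q
    rw [← neg_neg (S.boundary q _), ← ha.cap_boundary]
    exact neg_mem (cap_mem_chartRel ha.1 hc.2)

/-- The cap product with the eigenwave maps boundaries to boundaries. -/
lemma RepresentsEigenwave.cap_mem_boundaries (ha : RepresentsEigenwave a) {k q : ℕ}
    {c : S.PreChain (q + 1)} (hc : c ∈ boundaries (S.FZ k) (q + 1)) :
    cap a q c ∈ boundaries (S.FR (k + 1)) q := by
  obtain ⟨_, ⟨b, hb, rfl⟩, r, hr, rfl⟩ := AddSubgroup.mem_sup.1 hc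
  rw [map_add, ha.cap_boundary]
  exact add_mem (neg_mem (AddSubgroup.mem_sup_left ⟨_, cap_mem_chains ha.1 hb, rfl⟩))
    (AddSubgroup.mem_sup_right (cap_mem_chartRel ha.1 hr))

/-- The standard cochain contributes exactly zero. For the coboundary of `e` the homotopy leaves a
boundary and the product of `e` with `∂c`, which is zero modulo changes of charts. -/
lemma RepresentsEigenwave.cap_fundamentalChain_mem_boundaries (ha : RepresentsEigenwave a) {p : ℕ}
    {Z : S.StraightCycle (p + 1)} {c : S.PreChain (p + 1)} (hcZ : IsFundamentalChain Z c)
    (hc : c ∈ cycles (S.FZ (p + 1)) (p + 1)) : cap a p c ∈ boundaries (S.FR (p + 2)) p := by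
  obtain ⟨-, y, hy, e, he, hae⟩ := ha
  have h : cap a p c = cap (coboundaryZero e) p c := by
    have h1 := cap_liftDiff_fundamentalChain hcZ hy
    rw [cap_eq_capFaces] at h1 ⊢
    rw [cap_eq_capFaces, show a = fun s => liftDiff y s + coboundaryZero e s from funext hae,
      capFaces_add, AddMonoidHom.add_apply, h1, zero_add]
  rw [h, cap_coboundaryZero]
  exact sub_mem (AddSubgroup.mem_sup_right (capFaces_mem_chartRel he _ _ hc.2))
    (AddSubgroup.mem_sup_left ⟨_, capFaces_mem_chains he _ _ hc.1, rfl⟩)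

/-- A straight class has a representative whose cap product with the eigenwave is a boundary. -/
lemma RepresentsEigenwave.exists_representative (ha : RepresentsEigenwave a) {p : ℕ}
    {γ : Homology (S.FZ (p + 1)) (p + 1)} (hγ : γ ∈ S.straightClasses (p + 1)) :
    ∃ c : cycles (S.FZ (p + 1)) (p + 1), homologyClass c = γ ∧
      cap a p (c : S.PreChain (p + 1)) ∈ boundaries (S.FR (p + 2)) p := by
  induction hγ using AddSubgroup.closure_induction with
  | mem γ h =>
    obtain ⟨Z, c, hc, rfl⟩ := h
    exact ⟨c, rfl, ha.cap_fundamentalChain_mem_boundaries hc c.2⟩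
  | zero => exact ⟨0, rfl, by simp [zero_mem]⟩
  | add γ γ' _ _ h h' =>
    obtain ⟨c, rfl, hc⟩ := h
    obtain ⟨c', rfl, hc'⟩ := h'
    exact ⟨c + c', rfl, by
      rw [AddSubgroup.coe_add, map_add]
      exact add_mem hc hc'⟩
  | neg γ _ h =>
    obtain ⟨c, rfl, hc⟩ := h
    exact ⟨-c, rfl, by
      rw [AddSubgroup.coe_neg, map_neg]
      exact neg_mem hc⟩

end Eigenwave

end TropicalSpace

end TropGeom

end

theorem mainTheorem5 {X : Type*} [TopologicalSpace X] [CompactSpace X]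
    (S : TropGeom.TropicalSpace X) (p : ℕ)
    (γ : TropGeom.TropicalSpace.Homology (S.FZ (p + 1)) (p + 1))
    (hγ : γ ∈ S.straightClasses (p + 1))
    (a : ∀ s : S.Cell 1, TropGeom.Vec (S.N s.chart))
    (ha : TropGeom.TropicalSpace.RepresentsEigenwave a)
    (c : TropGeom.TropicalSpace.cycles (S.FZ (p + 1)) (p + 1))
    (hc : TropGeom.TropicalSpace.homologyClass c = γ) :
    ∃ h : TropGeom.TropicalSpace.cap a p (c : S.PreChain (p + 1)) ∈
        TropGeom.TropicalSpace.cycles (S.FR (p + 2)) p,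
      TropGeom.TropicalSpace.homologyClass
        (⟨TropGeom.TropicalSpace.cap a p (c : S.PreChain (p + 1)), h⟩ :
          TropGeom.TropicalSpace.cycles (S.FR (p + 2)) p) = 0 := by
  obtain ⟨c', hc', hb⟩ := ha.exists_representative hγ
  refine ⟨ha.cap_mem_cycles c.2, (QuotientAddGroup.eq_zero_iff _).2 ?_⟩
  -- The given cycle `c` and the sum `c'` of fundamental chains up to sign are homologous, and the
  -- cap product preserves boundaries.
  have h : -c' + c ∈ (TropGeom.TropicalSpace.boundaries (S.FZ (p + 1)) (p + 1)).addSubgroupOf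
      (TropGeom.TropicalSpace.cycles (S.FZ (p + 1)) (p + 1)) :=
    QuotientAddGroup.eq.1 (hc'.trans hc.symm)
  have h1 := ha.cap_mem_boundaries (AddSubgroup.mem_addSubgroupOf.1 h)
  rw [AddSubgroup.coe_add, AddSubgroup.coe_neg, map_add, map_neg] at h1
  rw [AddSubgroup.mem_addSubgroupOf]
  simpa using add_mem hb h1
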